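/- **Conventions.** Formulas are first-order formulas with equality (a logical symbol) over a countable signature and countably many variables; $\mathit{vars}(\varphi)$ is the set of variables of $\varphi$. A theory $\mathcal T$ is given by a set of sentences (axioms); a $\mathcal T$-interpretation is a structure with nonempty domain satisfying the axioms, together with a value for every variable. $\mathcal T$ is *decidable* if the set of $\mathcal T$-satisfiable quantifier-free formulas is decidable. For theories over disjoint signatures, $\mathcal T_1\oplus\mathcal T_2$ is the theory over the union of the signatures axiomatized by the union of the axioms. $\mathcal T$ is *smooth* if for every quantifier-free $\varphi$, every $\mathcal T$-interpretation $\mathcal A$ satisfying $\varphi$ and every cardinal $\kappa>|\mathrm{dom}(\mathcal A)|$ there is a $\mathcal T$-interpretation satisfying $\varphi$ with domain of cardinality $\kappa$. The *arrangement* $\delta_V$ on a finite set $V$ of variables induced by an equivalence relation $E$ on $V$ is the conjunction, over $x,y\in V$, of $x=y$ if $x\mathrel Ey$ and of $\neg(x=y)$ otherwise. A *strong witness* for $\mathcal T$ is a function $\mathit{wit}$ from quantifier-free formulas to quantifier-free formulas such that for every quantifier-free $\varphi$: (I) $\varphi$ and $\exists\vec x\,\mathit{wit}(\varphi)$, where $\vec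 x=\mathit{vars}(\mathit{wit}(\varphi))\setminus\mathit{vars}(\varphi)$, are satisfied by the same $\mathcal T$-interpretations; (II) if $\mathit{wit}(\varphi)$ is $\mathcal T$-satisfiable, then some $\mathcal T$-interpretation satisfying it has as domain exactly the set of values of the variables of $\mathit{wit}(\varphi)$; (II$'$) for every arrangement $\delta_V$ on a finite set of variables, if $\mathit{wit}(\varphi)\wedge\delta_V$ is $\mathcal T$-satisfiable, then some $\mathcal T$-interpretation satisfying it has as domain exactly the set of values of the variables of $\mathit{wit}(\varphi)\wedge\delta_V$. $\mathcal T$ is *strongly finitely witnessable* if it has a computable strong witness. **The theories.** $\mathcal T_=$ is the theory, over the signature with $0$-ary predicate symbols $P_1,P_2,\dots$ and no function symbols, with axioms $P_n\to\psi_{=n}$ for $n\ge1$, where $\psi_{=n}$ says that the domain has exactly $n$ elements. Call $f:\{1,2,\dots\}\to\{0,1\}$ *admissible* if $f$ is not computable, $f(1)=1$, and for every $k\ge1$ exactly half of the numbers in $\{1,\dots,2^k\}$ are mapped to $1$. Let $f_b(k)$ be the number of $i\in\{1,\dots,k\}$ with $f(i)=b$. $\mathcal T_f$ is the theory, over the signature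 with a single unary function symbol $s$ and no predicate symbols, with axioms $$\bigl[\psi^{=}_{\ge f_1(k)}\wedge\psi^{\neq}_{\ge f_0(k)}\bigr]\vee\bigvee_{i=1}^{k}\bigl[\psi^{=}_{=f_1(i)}\wedge\psi^{\neq}_{=f_0(i)}\bigr]\qquad(k\ge1),$$ where $\psi^{=}_{\ge n}$ and $\psi^{=}_{=n}$ say that at least, respectively exactly, $n$ elements $x$ satisfy $s(x)=x$, and $\psi^{\neq}_{\ge n}$ and $\psi^{\neq}_{=n}$ say the same with $s(x)\ne x$. **The function $\mathit{wit}_=$.** For a quantifier-free formula $\varphi$ over the signature of $\mathcal T_=$, let $c_1\vee\dots\vee c_r$ be the disjunctive normal form of $\varphi$ obtained by distributing (each $c_j$ a conjunction of literals), and let $w_1,w_2,\dots$ be variables that are not in $\mathit{vars}(\varphi)$. Put $$\mathit{wit}_=(\varphi)=\bigvee_{j=1}^r\Bigl(c_j\wedge w_1=w_1\wedge\bigwedge_{1\le a<b\le n_j}\neg(w_a=w_b)\Bigr),$$ where $n_j$ is the largest $n$ such that the literal $P_n$ is in $c_j$, and $n_j=0$ if there is none. **Theorem.** Admissible functions exist.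 $\mathcal T_=$ is decidable, is strongly finitely witnessable, with the computable strong witness $\mathit{wit}_=$, and is not smooth. For every admissible $f$, the theory $\mathcal T_f$ is decidable, and $\mathcal T_f\oplus\mathcal T_=$ is undecidable. Consequently there are decidable theories $\mathcal T_1=\mathcal T_f$ and $\mathcal T_2=\mathcal T_=$ over disjoint signatures such that $\mathcal T_2$ is strongly finitely witnessable but $\mathcal T_1\oplus\mathcal T_2$ is undecidable: smoothness cannot be dropped from the theorem that $\mathcal T_1\oplus\mathcal T_2$ is decidable whenever $\mathcal T_1,\mathcal T_2$ are decidable over disjoint signatures and $\mathcal T_2$ is smooth and strongly finitely witnessable. -/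

import Mathlib

open FirstOrder FirstOrder.Language

namespace TheoryCombination

/-! ### Interpretations, satisfiability, Gödel numbers, decidable theories

Equality is a logical symbol in Mathlib's first-order logic, so a signature is a
`FirstOrder.Language`. The variables are the natural numbers, so formulas are terms of type
`L.Formula ℕ`. Theories are given by their axioms. -/

/-- A `T`-interpretation: a structure satisfying the axioms of `T`, with a value for every
variable. The domain is nonempty because the variables take values in it. -/
structure Interp {L : FirstOrder.Language.{0, 0}} (T : L.Theory) where
  /-- The domain. -/
  Dom : Type
  /-- The meaning of the function and predicate symbols. -/
  [str : L.Structure Dom]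
  /-- The values of the variables. -/
  val : ℕ → Dom
  /-- The axioms hold. -/
  models : Dom ⊨ T

attribute [instance] Interp.str

/-- `A ⊨ φ`. -/
def Interp.Sat {L : FirstOrder.Language.{0, 0}} {T : L.Theory} (A : Interp T) (φ : L.Formula ℕ) : Prop :=
  φ.Realize A.val

/-- `φ` is `T`-satisfiable. -/
def Satisfiable {L : FirstOrder.Language.{0, 0}} (T : L.Theory) (φ : L.Formula ℕ) : Prop :=
  ∃ A : Interp T, A.Sat φ

/-- `φ` is quantifier-free. -/
abbrev QF {L : FirstOrder.Language.{0, 0}} (φ : L.Formula ℕ) : Prop := BoundedFormula.IsQF φ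

/-- The set of variables of a quantifier-free formula (all of them are free). -/
def vars {L : FirstOrder.Language.{0, 0}} (φ : L.Formula ℕ) : Finset ℕ := BoundedFormula.freeVarFinset φ

/-- A numbering of the symbols of a signature (separately for each arity and kind). -/
class SymbolCoding (L : FirstOrder.Language.{0, 0}) where
  /-- The number of a function symbol. -/
  funCode : ∀ {k : ℕ}, L.Functions k → ℕ
  /-- The number of a predicate symbol. -/
  relCode : ∀ {k : ℕ}, L.Relations k → ℕ
  funCode_injective : ∀ k : ℕ, Function.Injective (funCode : L.Functions k → ℕ)
  relCode_injective : ∀ k : ℕ, Function.Injective (relCode : L.Relations k → ℕ)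

/-- The Gödel number of a term. -/
def termCode {L : FirstOrder.Language.{0, 0}} [SymbolCoding L] {n : ℕ} : L.Term (ℕ ⊕ Fin n) → ℕ
  | .var (Sum.inl i) => 3 * i
  | .var (Sum.inr j) => 3 * (j : ℕ) + 1
  | .func (l := k) g ts =>
      3 * Nat.pair (Nat.pair k (SymbolCoding.funCode g))
        (Encodable.encode (List.ofFn fun i => termCode (ts i))) + 2

/-- The Gödel number of a formula. -/
def formulaCode {L : FirstOrder.Language.{0, 0}} [SymbolCoding L] : ∀ {n : ℕ}, L.BoundedFormula ℕ n → ℕ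
  | _, .falsum => 0
  | _, .equal t u => 4 * Nat.pair (termCode t) (termCode u) + 1
  | _, .rel (l := k) R ts =>
      4 * Nat.pair (Nat.pair k (SymbolCoding.relCode R))
        (Encodable.encode (List.ofFn fun i => termCode (ts i))) + 2
  | _, .imp φ ψ => 4 * Nat.pair (formulaCode φ) (formulaCode ψ) + 3
  | _, .all φ => 4 * formulaCode φ + 4

/-- `T` is decidable: the set of `T`-satisfiable quantifier-free formulas is decidable. -/
def DecidableTheory {L : FirstOrder.Language.{0, 0}} [SymbolCoding L] (T : L.Theory) : Prop :=
  ComputablePred fun c : ℕ => ∃ φ : L.Formula ℕ, QF φ ∧ formulaCode φ = c ∧ Satisfiable T φ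

/-- The map `w` on quantifier-free formulas is computable. -/
def ComputableOnQF {L : FirstOrder.Language.{0, 0}} [SymbolCoding L] (w : L.Formula ℕ → L.Formula ℕ) : Prop :=
  ∃ g : ℕ → ℕ, Computable g ∧ ∀ φ : L.Formula ℕ, QF φ → g (formulaCode φ) = formulaCode (w φ)

/-! ### Combinations -/

/-- The numbering of the symbols of the disjoint union of two signatures. -/
instance sumCoding (L₁ L₂ : FirstOrder.Language.{0, 0}) [SymbolCoding L₁] [SymbolCoding L₂] :
    SymbolCoding (L₁.sum L₂) where
  funCode := Sum.elim (fun g => 2 * SymbolCoding.funCode g)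
    (fun g => 2 * SymbolCoding.funCode g + 1)
  relCode := Sum.elim (fun R => 2 * SymbolCoding.relCode R)
    (fun R => 2 * SymbolCoding.relCode R + 1)
  funCode_injective k := by
    rintro (a | a) (b | b) h <;> simp only [Sum.elim_inl, Sum.elim_inr] at h
    · exact congrArg _ (SymbolCoding.funCode_injective k (by omega))
    · omega
    · omega
    · exact congrArg _ (SymbolCoding.funCode_injective k (by omega))
  relCode_injective k := by
    rintro (a | a) (b | b) h <;> simp only [Sum.elim_inl, Sum.elim_inr] at h
    · exact congrArg _ (SymbolCoding.relCode_injective k (by omega))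
    · omega
    · omega
    · exact congrArg _ (SymbolCoding.relCode_injective k (by omega))

/-- `T₁ ⊕ T₂`: the theory over the union of the two disjoint signatures that is axiomatized by the
axioms of `T₁` and those of `T₂`. -/
def combination {L₁ L₂ : FirstOrder.Language.{0, 0}} (T₁ : L₁.Theory) (T₂ : L₂.Theory) :
    (L₁.sum L₂).Theory :=
  (LHom.sumInl : L₁ →ᴸ L₁.sum L₂).onTheory T₁ ∪ (LHom.sumInr : L₂ →ᴸ L₁.sum L₂).onTheory T₂

/-! ### Smoothness and strong finite witnessability -/

/-- `T` is smooth. -/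
def Smooth {L : FirstOrder.Language.{0, 0}} (T : L.Theory) : Prop :=
  ∀ φ : L.Formula ℕ, QF φ → ∀ A : Interp T, A.Sat φ → ∀ κ : Cardinal.{0}, Cardinal.mk A.Dom < κ →
    ∃ B : Interp T, B.Sat φ ∧ Cardinal.mk B.Dom = κ

/-- The conjunction of a list of formulas. -/
def bigAnd {L : FirstOrder.Language.{0, 0}} (l : List (L.Formula ℕ)) : L.Formula ℕ :=
  l.foldr (· ⊓ ·) ⊤

/-- The disjunction of a list of formulas. -/
def bigOr {L : FirstOrder.Language.{0, 0}} (l : List (L.Formula ℕ)) : L.Formula ℕ :=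
  l.foldr (· ⊔ ·) ⊥

/-- The equation `x = y` between two variables. -/
def eqVar {L : FirstOrder.Language.{0, 0}} {α : Type} (x y : α) : L.Formula α :=
  Term.equal (Term.var x) (Term.var y)

open Classical in
/-- The arrangement on `V` induced by the equivalence relation `E` on `V`. -/
noncomputable def arrangement {L : FirstOrder.Language.{0, 0}} (V : Finset ℕ) (E : Setoid V) : L.Formula ℕ :=
  bigAnd ((Finset.univ : Finset (V × V)).toList.map fun p =>
    if E p.1 p.2 then eqVar (p.1 : ℕ) (p.2 : ℕ) else ∼(eqVar (p.1 : ℕ) (p.2 : ℕ)))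

/-- The domain of `A` is the set of values of the variables of `φ`. -/
def Interp.Minimal {L : FirstOrder.Language.{0, 0}} {T : L.Theory} (A : Interp T) (φ : L.Formula ℕ) : Prop :=
  ∀ a : A.Dom, ∃ x ∈ vars φ, A.val x = a

/-- `wit` is a witness for `T`. In `equiv`, the right-hand side says that `A` satisfies
`∃ x⃗, wit φ`, where `x⃗ = vars (wit φ) \ vars φ`. -/
structure IsWitness {L : FirstOrder.Language.{0, 0}} (T : L.Theory) (wit : L.Formula ℕ → L.Formula ℕ) :
    Prop where
  qf : ∀ φ, QF φ → QF (wit φ)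
  equiv : ∀ φ, QF φ → ∀ A : Interp T, A.Sat φ ↔
    ∃ v : ℕ → A.Dom, (∀ x, x ∉ vars (wit φ) \ vars φ → v x = A.val x) ∧ (wit φ).Realize v
  minimal : ∀ φ, QF φ → Satisfiable T (wit φ) →
    ∃ A : Interp T, A.Sat (wit φ) ∧ A.Minimal (wit φ)

/-- `wit` is a strong witness for `T`. -/
structure IsStrongWitness {L : FirstOrder.Language.{0, 0}} (T : L.Theory)
    (wit : L.Formula ℕ → L.Formula ℕ) : Prop extends IsWitness T wit where
  strong : ∀ φ, QF φ → ∀ (V : Finset ℕ) (E : Setoid V),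
    Satisfiable T (wit φ ⊓ arrangement V E) →
    ∃ A : Interp T, A.Sat (wit φ ⊓ arrangement V E) ∧ A.Minimal (wit φ ⊓ arrangement V E)

/-- `T` is strongly finitely witnessable (with a computable strong witness). -/
def StronglyFinitelyWitnessable {L : FirstOrder.Language.{0, 0}} [SymbolCoding L] (T : L.Theory) : Prop :=
  ∃ wit : L.Formula ℕ → L.Formula ℕ, ComputableOnQF wit ∧ IsStrongWitness T wit

/-! ### Cardinality formulas -/

/-- `⋀_{i < j} ¬ (x i = x j)` for variables `x 0, …, x (n-1)`. -/
noncomputable def distinct {L : FirstOrder.Language.{0, 0}} {α : Type} {n : ℕ} (x : Fin n → α) :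
    L.Formula α :=
  Formula.iInf fun p : {p : Fin n × Fin n // p.1 < p.2} => ∼(eqVar (x p.1.1) (x p.1.2))

/-- `ψ_{≥ n}`. -/
noncomputable def psiGe (L : FirstOrder.Language.{0, 0}) (n : ℕ) : L.Sentence :=
  Formula.iExs (Fin n) (distinct fun i => Sum.inr i)

/-- `ψ_{≤ n}`: `∃ x₁ … xₙ, ∀ y, ⋁ i, y = xᵢ`. -/
noncomputable def psiLe (L : FirstOrder.Language.{0, 0}) (n : ℕ) : L.Sentence :=
  Formula.iExs (Fin n) (Formula.iAlls Unit
    (Formula.iSup fun i : Fin n => eqVar (Sum.inr ()) (Sum.inl (Sum.inr i))))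

/-- `ψ_{= n}`. -/
noncomputable def psiEq (L : FirstOrder.Language.{0, 0}) (n : ℕ) : L.Sentence := psiGe L n ⊓ psiLe L n

/-! ### The theory `T_=` -/

/-- The predicate symbols `P₁, P₂, …`, all of arity `0`. -/
inductive PRel : ℕ → Type
  | P (n : ℕ+) : PRel 0

/-- The index of a predicate symbol. -/
def PRel.index : ∀ {k : ℕ}, PRel k → ℕ
  | _, .P n => n

/-- The signature with the propositional symbols `P₁, P₂, …` and no function symbols. -/
def SigP : FirstOrder.Language.{0, 0} := ⟨fun _ => Empty, PRel⟩

instance : SymbolCoding SigP where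
  funCode := Empty.elim
  relCode := PRel.index
  funCode_injective _ := fun a => Empty.elim a
  relCode_injective k := by
    rintro ⟨m⟩ ⟨n⟩ h
    exact congrArg PRel.P (PNat.eq h)

/-- `P n` as a symbol of the signature. -/
def symP (n : ℕ+) : SigP.Relations 0 := PRel.P n

/-- The atomic sentence `P n`. -/
def atomP {α : Type} (n : ℕ+) : SigP.Formula α := (symP n).formula Fin.elim0

/-- `T_=`, axiomatized by `P n → ψ_{= n}` for `n ≥ 1`. -/
noncomputable def theoryEq : SigP.Theory :=
  Set.range fun n : ℕ+ => (atomP n : SigP.Sentence).imp (psiEq SigP n)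

/-! ### The strong witness for `T_=` -/

/-- A literal: an atomic formula together with its sign. -/
abbrev Lit (L : FirstOrder.Language.{0, 0}) := Bool × L.Formula ℕ

/-- The formula denoted by a literal. -/
def Lit.toFormula {L : FirstOrder.Language.{0, 0}} (l : Lit L) : L.Formula ℕ :=
  if l.1 then l.2 else ∼l.2

/-- A disjunctive normal form of `φ` (for `b = true`), respectively of `¬ φ` (for `b = false`), as
a list of cubes, each of them a list of literals. The value at quantified formulas is irrelevant. -/
def dnf {L : FirstOrder.Language.{0, 0}} : ∀ {n : ℕ}, L.BoundedFormula ℕ n → Bool →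
    List (List (Bool × L.BoundedFormula ℕ n))
  | _, .falsum, true => []
  | _, .falsum, false => [ [] ]
  | _, .equal t u, b => [ [(b, .equal t u)] ]
  | _, .rel R ts, b => [ [(b, .rel R ts)] ]
  | _, .imp φ ψ, true => dnf φ false ++ dnf ψ true
  | _, .imp φ ψ, false => (dnf φ true).flatMap fun c => (dnf ψ false).map fun d => c ++ d
  | _, .all _, _ => []

/-- `n` for the literal `P n`, and `0` for every other literal. -/
def Lit.posIndex : Lit SigP → ℕ
  | (true, .rel R _) => PRel.index R
  | _ => 0

/-- The largest `n` such that the literal `P n` is in the cube `c`, and `0` if there is none. -/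
def maxPosIndex (c : List (Lit SigP)) : ℕ := (c.map Lit.posIndex).foldr max 0

/-- The least `k` such that `k, k + 1, …` are not variables of `φ`. -/
def freshIndex {L : FirstOrder.Language.{0, 0}} (φ : L.Formula ℕ) : ℕ := (vars φ).sup Nat.succ

/-- The strong witness on a cube `c`, with fresh variables `wᵢ = k + i`, `i = 0, 1, …`:
it is `c ∧ w₀ = w₀ ∧ ⋀_{i < j < n} ¬ (wᵢ = wⱼ)`, where `n` is the largest number such that the
literal `P n` is in `c` (and `n = 0`, so that the last conjunct is empty, if there is none). -/
def cubeWit (k : ℕ) (c : List (Lit SigP)) : SigP.Formula ℕ :=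
  bigAnd (c.map Lit.toFormula) ⊓ (eqVar k k ⊓
    bigAnd ((List.range (maxPosIndex c)).flatMap fun j =>
      (List.range j).map fun i => ∼(eqVar (k + i) (k + j))))

/-- The strong witness: the disjunction of the witnesses of the cubes of a disjunctive normal
form. -/
def witEq (φ : SigP.Formula ℕ) : SigP.Formula ℕ :=
  bigOr ((dnf φ true).map (cubeWit (freshIndex φ)))

/-! ### The theory `T_f` -/

/-- The unary function symbol `s`. -/
inductive SFunc : ℕ → Type
  | s : SFunc 1

/-- The signature with one unary function symbol `s` and no predicate symbols. -/
def SigS : FirstOrder.Language.{0, 0} := ⟨SFunc, fun _ => Empty⟩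

instance : SymbolCoding SigS where
  funCode := fun _ => 0
  relCode := Empty.elim
  funCode_injective k := by
    rintro ⟨⟩ ⟨⟩ _
    rfl
  relCode_injective _ := fun a => Empty.elim a

/-- `s` as a symbol of the signature. -/
def symS : SigS.Functions 1 := SFunc.s

/-- `p x`, that is `s x = x`, for `b = true`; `¬ p x` for `b = false`. -/
def fixLit {α : Type} (b : Bool) (x : α) : SigS.Formula α :=
  let p : SigS.Formula α := Term.equal (symS.apply₁ (Term.var x)) (Term.var x)
  if b then p else ∼p

/-- `ψ^=_{≥ n}` for `b = true` and `ψ^≠_{≥ n}` for `b = false`. -/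
noncomputable def psiFixGe (b : Bool) (n : ℕ) : SigS.Sentence :=
  Formula.iExs (Fin n)
    (distinct (fun i => Sum.inr i) ⊓ Formula.iInf fun i : Fin n => fixLit b (Sum.inr i))

/-- `ψ^=_{= n}` for `b = true` and `ψ^≠_{= n}` for `b = false`. -/
noncomputable def psiFixEq (b : Bool) (n : ℕ) : SigS.Sentence :=
  Formula.iExs (Fin n)
    (distinct (fun i => Sum.inr i) ⊓ (Formula.iInf (fun i : Fin n => fixLit b (Sum.inr i)) ⊓
      Formula.iAlls Unit ((fixLit b (Sum.inr ())).imp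
        (Formula.iSup fun i : Fin n => eqVar (Sum.inr ()) (Sum.inl (Sum.inr i))))))

/-- The number of `i ∈ {1, …, k}` with `f i = b`: this is `f₁ k` for `b = true`, and `f₀ k` for
`b = false`. -/
def count (f : ℕ → Bool) (b : Bool) (k : ℕ) : ℕ := ((Finset.Icc 1 k).filter fun i => f i = b).card

/-- The functions `f : {1, 2, …} → {0, 1}` that the theories `T_f` are built from, with `true` for
`1` and `false` for `0`. The value `f 0` plays no role. -/
structure IsAdmissible (f : ℕ → Bool) : Prop where
  one : f 1 = true
  balanced : ∀ k : ℕ, 1 ≤ k → count f true (2 ^ k) = count f false (2 ^ k)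
  not_computable : ¬ Computable f

/-- The axiom of `T_f` with index `k`. -/
noncomputable def axiomF (f : ℕ → Bool) (k : ℕ) : SigS.Sentence :=
  (psiFixGe true (count f true k) ⊓ psiFixGe false (count f false k)) ⊔
    Formula.iSup fun i : Fin k =>
      psiFixEq true (count f true (i + 1)) ⊓ psiFixEq false (count f false (i + 1))

/-- `T_f`. -/
noncomputable def theoryF (f : ℕ → Bool) : SigS.Theory :=
  {σ | ∃ k : ℕ, 1 ≤ k ∧ σ = axiomF f k}

end TheoryCombination

/-! In `theoryEq`, a true `P n` forces exactly `n` elements, so at most one predicate symbol is true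
in a model. Satisfiability of a quantifier-free formula then depends only on which of its variables
are equal and on which single `P m`, if any, is true: finitely much data. For the theory `theoryF
f`, quantifier-free formulas impose no cardinality constraint at all. Any structure satisfying the
formula can be enlarged by infinitely many fixed points and infinitely many non-fixed points of `s`,
after which the first disjunct of every axiom holds. So satisfiability in `theoryF f` is
satisfiability in some structure, and the decision procedure never consults `f`. In both cases an
interpretation is packed into the digits of one number below a bound that is computed from the Gödel
number of the formula, and satisfiability becomes a bounded search (`decidableTheory_of_search`).

The combination is harder because `P n` can now fix the size of a model of `theoryF f`. A finite
model with `n` elements has exactly `count f true n` fixed points (`models_theoryF_iff_card`), so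
"`P n` holds and there are `m` distinct fixed points" is satisfiable iff `m ≤ count f true n`
(`satisfiable_queryFormula_iff`). A decision procedure would compute `count f true`, and `f` is read
off from its increments.

For the strong witness, consider one cube (`witEq_minimal`). If it contains a literal `P n`, the
domain has `n` elements and the `n` pairwise distinct fresh variables name all of them. If it
contains none, the domain is cut down to the values of the variables and every `P n` is made false.
An arrangement depends only on the equalities between variables, so it survives both constructions.
Smoothness fails because `P 1` has no model with two elements.

Admissible functions come from the halting problem: consecutive places carry a bit and its
complement, which keeps the count balanced. -/

namespace TheoryCombination

/-! ### Folds over Gödel numbers -/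

section Folds

variable {σ : Type}

/-- Recursion over Gödel numbers of formulas: implications are handled by `node`, everything else
by `leaf`. -/
def codeFold (leaf : ℕ → σ) (node : σ → σ → σ) (c : ℕ) : σ :=
  if h : c % 4 = 3 then
    node (codeFold leaf node (c / 4).unpair.1) (codeFold leaf node (c / 4).unpair.2)
  else leaf c
termination_by c
decreasing_by
  · exact (Nat.unpair_left_le _).trans_lt (by omega)
  · exact (Nat.unpair_right_le _).trans_lt (by omega)

theorem codeFold_leaf (leaf : ℕ → σ) (node : σ → σ → σ) {c : ℕ} (h : c % 4 ≠ 3) :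
    codeFold leaf node c = leaf c := by
  rw [codeFold, dif_neg h]

theorem codeFold_imp (leaf : ℕ → σ) (node : σ → σ → σ) (a b : ℕ) :
    codeFold leaf node (4 * Nat.pair a b + 3) =
      node (codeFold leaf node a) (codeFold leaf node b) := by
  rw [codeFold, dif_pos (by omega)]
  have : (4 * Nat.pair a b + 3) / 4 = Nat.pair a b := by omega
  simp [this]

/-- The Gödel number of the argument in the Gödel number of a term that starts with a unary function
symbol. -/
def argCode (t : ℕ) : ℕ := ((t / 3).unpair.2 - 1).unpair.1

theorem primrec_argCode : Primrec argCode :=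
  Primrec.fst.comp <| Primrec.unpair.comp <| Primrec.nat_sub.comp (Primrec.snd.comp <|
    Primrec.unpair.comp <| Primrec.nat_div.comp Primrec.id (Primrec.const 3)) (Primrec.const 1)

theorem argCode_lt {t : ℕ} (h : t % 3 = 2) : argCode t < t :=
  (Nat.unpair_left_le _).trans_lt <|
    (Nat.sub_le _ _).trans_lt ((Nat.unpair_right_le _).trans_lt (by omega))

/-- Recursion over Gödel numbers of terms with unary function symbols. -/
def termFold (leaf : ℕ → σ) (node : ℕ → σ → σ) (t : ℕ) : σ :=
  if _h : t % 3 = 2 then node t (termFold leaf node (argCode t)) else leaf t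
termination_by t
decreasing_by exact argCode_lt ‹_›

variable {α : Type} [Primcodable α] [Primcodable σ]

/-- Course-of-values recursion: both parts of an implication have smaller codes, so the value at `c`
is found by two lookups in the list of the values at `0, …, c - 1`, whose length is `c` itself. The
parameter `a` will carry a coded interpretation. -/
theorem primrec_codeFold {leaf : α → ℕ → σ} {node : α → σ × σ → σ} (hl : Primrec₂ leaf)
    (hn : Primrec₂ node) :
    Primrec₂ fun a c => codeFold (leaf a) (fun x y => node a (x, y)) c := by
  refine Primrec.nat_strong_rec _ (g := fun a l =>
    if l.length % 4 = 3 then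
      (l[(l.length / 4).unpair.1]?).bind fun x =>
        (l[(l.length / 4).unpair.2]?).map fun y => node a (x, y)
    else some (leaf a l.length)) ?_ ?_
  · have hlen : Primrec fun p : α × List σ => p.2.length := Primrec.list_length.comp Primrec.snd
    have hq : Primrec fun p : α × List σ => (p.2.length / 4).unpair :=
      Primrec.unpair.comp (Primrec.nat_div.comp hlen (Primrec.const 4))
    refine Primrec.ite (Primrec.eq.comp (Primrec.nat_mod.comp hlen (Primrec.const 4))
      (Primrec.const 3)) ?_ ?_
    · refine Primrec.option_bind
        (Primrec.list_getElem?.comp Primrec.snd (Primrec.fst.comp hq)) ?_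
      refine Primrec.option_map (Primrec.list_getElem?.comp (Primrec.snd.comp Primrec.fst)
        (Primrec.snd.comp (hq.comp Primrec.fst))) ?_
      exact hn.comp (Primrec.fst.comp (Primrec.fst.comp Primrec.fst))
        (Primrec.pair (Primrec.snd.comp Primrec.fst) Primrec.snd)
    · exact Primrec.option_some.comp (hl.comp Primrec.fst hlen)
  · intro a c
    have h1 : c % 4 = 3 → (c / 4).unpair.1 < c := fun h =>
      (Nat.unpair_left_le _).trans_lt (by omega)
    have h2 : c % 4 = 3 → (c / 4).unpair.2 < c := fun h =>
      (Nat.unpair_right_le _).trans_lt (by omega)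
    conv_rhs => rw [codeFold]
    split_ifs with h h' h'
    · simp [h1 h', h2 h']
    all_goals simp_all

theorem primrec_termFold {leaf : α → ℕ → σ} {node : α → ℕ × σ → σ} (hl : Primrec₂ leaf)
    (hn : Primrec₂ node) :
    Primrec₂ fun a t => termFold (leaf a) (fun x y => node a (x, y)) t := by
  refine Primrec.nat_strong_rec _ (g := fun a l =>
    if l.length % 3 = 2 then
      (l[argCode l.length]?).map fun x => node a (l.length, x)
    else some (leaf a l.length)) ?_ ?_
  · have hlen : Primrec fun p : α × List σ => p.2.length := Primrec.list_length.comp Primrec.snd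
    refine Primrec.ite (Primrec.eq.comp (Primrec.nat_mod.comp hlen (Primrec.const 3))
      (Primrec.const 2)) ?_ ?_
    · refine Primrec.option_map
        (Primrec.list_getElem?.comp Primrec.snd (primrec_argCode.comp hlen)) ?_
      exact hn.comp (Primrec.fst.comp Primrec.fst)
        (Primrec.pair (hlen.comp Primrec.fst) Primrec.snd)
    · exact Primrec.option_some.comp (hl.comp Primrec.fst hlen)
  · intro a t
    conv_rhs => rw [termFold]
    split_ifs with h h' h'
    · simp [argCode_lt (t := t) (by simpa using h)]
    all_goals simp_all

end Folds

/-! ### Functions with bounded values as digit expansions -/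

/-- The digit of `V` with index `i` in base `B`. -/
def digit (B V i : ℕ) : ℕ := V / B ^ i % B

/-- Packs a finite table with bounded entries into one bounded number, which turns a search for an
interpretation into a search for a number. -/
theorem exists_digits {B : ℕ} (n : ℕ) (h : ℕ → ℕ) (hh : ∀ i < n, h i < B) :
    ∃ V < B ^ n, ∀ i < n, digit B V i = h i := by
  induction n with
  | zero => exact ⟨0, by simp, by simp⟩
  | succ n ih =>
    obtain ⟨V, hV, hd⟩ := ih fun i hi => hh i (by omega)
    have hn := hh n (by omega)
    have hB : 0 < B := by omega
    refine ⟨V + B ^ n * h n, ?_, fun i hi => ?_⟩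
    · calc V + B ^ n * h n < B ^ n + B ^ n * h n := by omega
        _ = B ^ n * (h n + 1) := by ring
        _ ≤ B ^ n * B := Nat.mul_le_mul_left _ hn
        _ = B ^ (n + 1) := (pow_succ _ _).symm
    · rcases Nat.lt_succ_iff_lt_or_eq.1 hi with hi' | rfl
      · rw [← hd i hi', digit, digit]
        -- For `i < n` the new leading term is a multiple of `B ^ (i + 1)`, so it does not affect
        -- the digit `i`.
        have : B ^ n * h n = B ^ i * (B * (B ^ (n - i - 1) * h n)) := by
          rw [← mul_assoc, ← mul_assoc, ← pow_succ, ← pow_add]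
          congr 2; omega
        rw [this, Nat.add_mul_div_left _ _ (by positivity), Nat.add_mul_mod_self_left]
      · rw [digit, Nat.add_mul_div_left _ _ (by positivity), Nat.div_eq_of_lt hV, zero_add,
          Nat.mod_eq_of_lt hn]

theorem primrec_pow : Primrec₂ ((· ^ ·) : ℕ → ℕ → ℕ) := by
  refine (Primrec.nat_rec (f := fun _ : ℕ => 1) (g := fun b p => p.2 * b) (Primrec.const 1)
    (Primrec.nat_mul.comp (Primrec.snd.comp Primrec.snd) Primrec.fst)).of_eq fun b n => ?_
  induction n with
  | zero => rfl
  | succ n ih => simpa [pow_succ] using congrArg (· * b) ih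

theorem Primrec.digit {α : Type} [Primcodable α] {f g h : α → ℕ} (hf : Primrec f) (hg : Primrec g)
    (hh : Primrec h) : Primrec fun a => digit (f a) (g a) (h a) :=
  Primrec.nat_mod.comp (Primrec.nat_div.comp hg (primrec_pow.comp hf hh)) hf

/-! ### Gödel numbers of quantifier-free formulas -/

section QF

variable {L : FirstOrder.Language.{0, 0}} [SymbolCoding L]

/-- Gödel number of an implication. -/
def impCode (a b : ℕ) : ℕ := 4 * Nat.pair a b + 3

theorem formulaCode_imp {n : ℕ} (φ ψ : L.BoundedFormula ℕ n) :
    formulaCode (φ.imp ψ) = impCode (formulaCode φ) (formulaCode ψ) := by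
  simp [formulaCode, impCode]

theorem formulaCode_falsum {n : ℕ} :
    formulaCode (BoundedFormula.falsum : L.BoundedFormula ℕ n) = 0 := by
  simp [formulaCode]

theorem formulaCode_bot {n : ℕ} : formulaCode (⊥ : L.BoundedFormula ℕ n) = 0 :=
  formulaCode_falsum

theorem formulaCode_atom_mod {n : ℕ} {φ : L.BoundedFormula ℕ n} (h : φ.IsAtomic) :
    formulaCode φ % 4 = 1 ∨ formulaCode φ % 4 = 2 := by
  cases h with
  | equal t u => left; simp only [Term.bdEqual, formulaCode]; omega
  | rel R ts => right; simp only [Relations.boundedFormula, formulaCode]; omega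

theorem formulaCode_atom_mod_ne {n : ℕ} {φ : L.BoundedFormula ℕ n} (h : φ.IsAtomic) :
    formulaCode φ % 4 ≠ 3 := by
  have := formulaCode_atom_mod h
  omega

/-- Every number congruent to 3 modulo 4 splits into two smaller codes, so only leaves need a test.
Quantified formulas have codes `4 * a + 4`, which are leaves, and `ok` rejects them. -/
theorem codeFold_and_iff {ok : ℕ → Bool}
    (hok : ∀ c, c % 4 ≠ 3 →
      (ok c = true ↔ c = 0 ∨ ∃ φ : L.Formula ℕ, BoundedFormula.IsAtomic φ ∧ formulaCode φ = c))
    (c : ℕ) : codeFold ok (· && ·) c = true ↔ ∃ φ : L.Formula ℕ, QF φ ∧ formulaCode φ = c := by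
  constructor
  · induction c using Nat.strong_induction_on with
    | _ c ih =>
      intro h
      by_cases hc : c % 4 = 3
      · obtain ⟨a, b, rfl⟩ : ∃ a b, c = 4 * Nat.pair a b + 3 :=
          ⟨(c / 4).unpair.1, (c / 4).unpair.2, by rw [Nat.pair_unpair]; omega⟩
        rw [codeFold_imp, Bool.and_eq_true] at h
        obtain ⟨φ, hφ, rfl⟩ := ih a (by have := Nat.left_le_pair a b; omega) h.1
        obtain ⟨ψ, hψ, rfl⟩ := ih b (by have := Nat.right_le_pair (formulaCode φ) b; omega) h.2
        exact ⟨φ.imp ψ, hφ.imp hψ, formulaCode_imp φ ψ⟩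
      · rw [codeFold_leaf _ _ hc, hok c hc] at h
        rcases h with rfl | ⟨φ, hφ, rfl⟩
        · exact ⟨⊥, BoundedFormula.isQF_bot, formulaCode_bot⟩
        · exact ⟨φ, hφ.isQF, rfl⟩
  · rintro ⟨φ, hφ, rfl⟩
    induction hφ with
    | falsum =>
      rw [formulaCode_falsum, codeFold_leaf _ _ (by omega), hok _ (by omega)]
      exact Or.inl rfl
    | of_isAtomic h =>
      have hm := formulaCode_atom_mod_ne h
      rw [codeFold_leaf _ _ hm, hok _ hm]
      exact Or.inr ⟨_, h, rfl⟩
    | imp _ _ h₁ h₂ => rw [formulaCode_imp, impCode, codeFold_imp, h₁, h₂]; rfl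

/-- Subformulas have smaller codes, so truth of `φ` only requires correct values at atoms with code
at most `N`. This is why a finite table suffices. -/
theorem codeFold_imp_iff {M : Type} [L.Structure M] (v : ℕ → M) {leaf : ℕ → Bool} {N : ℕ}
    (h0 : leaf 0 = false)
    (hleaf : ∀ φ : L.Formula ℕ, BoundedFormula.IsAtomic φ → formulaCode φ ≤ N →
      (leaf (formulaCode φ) = true ↔ φ.Realize v))
    {φ : L.Formula ℕ} (hφ : QF φ) (hN : formulaCode φ ≤ N) :
    codeFold leaf (fun x y => !x || y) (formulaCode φ) = true ↔ φ.Realize v := by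
  induction hφ with
  | falsum =>
    rw [formulaCode_falsum, codeFold_leaf _ _ (by omega), h0]
    exact iff_of_false Bool.false_ne_true id
  | of_isAtomic h =>
    have hm := formulaCode_atom_mod_ne h
    rw [codeFold_leaf _ _ hm]
    exact hleaf _ h hN
  | @imp φ ψ _ _ h₁ h₂ =>
    rw [formulaCode_imp, impCode] at hN
    have := Nat.left_le_pair (formulaCode φ) (formulaCode ψ)
    have := Nat.right_le_pair (formulaCode φ) (formulaCode ψ)
    have h₁ := h₁ (by omega)
    have h₂ := h₂ (by omega)
    rw [formulaCode_imp, impCode, codeFold_imp, Formula.realize_imp, ← h₁, ← h₂]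
    cases codeFold leaf (fun x y => !x || y) (formulaCode φ) <;> simp

end QF

/-! ### Decidability by bounded search -/

theorem computablePred_of_primrecPred {α : Type} [Primcodable α] {p : α → Prop}
    (hp : PrimrecPred p) : ComputablePred p := by
  obtain ⟨h, hp⟩ := hp
  exact ⟨h, hp.to_comp⟩

/-- A theory is decidable if the Gödel numbers of its atoms are primitive recursive, and the
satisfiability of a formula can be tested by a search, below a primitive recursive bound, for a
number `W` that codes an interpretation whose atomic diagram is primitive recursive. -/
theorem decidableTheory_of_search {L : FirstOrder.Language.{0, 0}} [SymbolCoding L] {T : L.Theory}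
    {ok : ℕ → Bool} {leaf : ℕ × ℕ → ℕ → Bool} (hok : Primrec ok) (hleaf : Primrec₂ leaf)
    (hatom : ∀ c, c % 4 ≠ 3 →
      (ok c = true ↔ c = 0 ∨ ∃ φ : L.Formula ℕ, BoundedFormula.IsAtomic φ ∧ formulaCode φ = c))
    (hsat : ∀ φ : L.Formula ℕ, QF φ → (Satisfiable T φ ↔
      ∃ W < (formulaCode φ + 1) ^ (2 * formulaCode φ + 2),
        codeFold (leaf (formulaCode φ, W)) (fun x y => !x || y) (formulaCode φ) = true)) :
    DecidableTheory T := by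
  have hvalid : Primrec fun c => codeFold ok (· && ·) c :=
    (primrec_codeFold (α := Unit) (leaf := fun _ => ok) (node := fun _ p => p.1 && p.2)
      (hok.comp Primrec.snd) (Primrec.and.comp (Primrec.fst.comp Primrec.snd)
        (Primrec.snd.comp Primrec.snd))).comp (Primrec.const ()) Primrec.id
  have heval : PrimrecRel fun W c : ℕ =>
      codeFold (leaf (c, W)) (fun x y => !x || y) c = true := by
    refine Primrec.eq.comp ?_ (Primrec.const true)
    exact (primrec_codeFold hleaf (node := fun _ p => !p.1 || p.2)
      (Primrec.or.comp (Primrec.not.comp (Primrec.fst.comp Primrec.snd))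
        (Primrec.snd.comp Primrec.snd))).comp (Primrec.pair Primrec.snd Primrec.fst) Primrec.snd
  -- There are `2 * c + 2` digits in base `c + 1`: the places `0, …, c` for the variables, and `c +
  -- 1` further places for the remaining data (the modulus for `theoryEq`, the table of `s` for
  -- `theoryF f`).
  have hbound : Primrec fun c : ℕ => (c + 1) ^ (2 * c + 2) :=
    primrec_pow.comp Primrec.succ (Primrec.succ.comp Primrec.nat_double_succ)
  have key : PrimrecPred fun c : ℕ => codeFold ok (· && ·) c = true ∧
      ∃ W < (c + 1) ^ (2 * c + 2), codeFold (leaf (c, W)) (fun x y => !x || y) c = true :=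
    (Primrec.eq.comp hvalid (Primrec.const true)).and (heval.exists_lt.comp hbound Primrec.id)
  refine (computablePred_of_primrecPred key).of_eq fun c => ?_
  rw [codeFold_and_iff hatom]
  constructor
  · rintro ⟨⟨φ, hφ, rfl⟩, h⟩
    exact ⟨φ, hφ, rfl, (hsat φ hφ).2 h⟩
  · rintro ⟨φ, hφ, rfl, h⟩
    exact ⟨⟨φ, hφ, rfl⟩, (hsat φ hφ).1 h⟩

/-! ### Syntax and semantics of small formulas -/

section Realize

variable {L : FirstOrder.Language.{0, 0}} {M : Type} [L.Structure M]

@[simp]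
theorem realize_eqVar {α : Type} {v : α → M} {x y : α} :
    (eqVar x y : L.Formula α).Realize v ↔ v x = v y := by
  simp [eqVar]

@[simp]
theorem realize_bigAnd {v : ℕ → M} {l : List (L.Formula ℕ)} :
    (bigAnd l).Realize v ↔ ∀ φ ∈ l, φ.Realize v :=
  BoundedFormula.realize_foldr_inf l v default

@[simp]
theorem realize_bigOr {v : ℕ → M} {l : List (L.Formula ℕ)} :
    (bigOr l).Realize v ↔ ∃ φ ∈ l, φ.Realize v :=
  BoundedFormula.realize_foldr_sup l v default

theorem realize_iInf' {ι α : Type} [Finite ι] {f : ι → L.Formula α} {v : α → M} :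
    (Formula.iInf f).Realize v ↔ ∀ i, (f i).Realize v := by
  simp [Formula.iInf, Formula.Realize]

theorem realize_iSup' {ι α : Type} [Finite ι] {f : ι → L.Formula α} {v : α → M} :
    (Formula.iSup f).Realize v ↔ ∃ i, (f i).Realize v := by
  simp [Formula.iSup, Formula.Realize]

theorem realize_distinct {α : Type} {n : ℕ} {x : Fin n → α} {v : α → M} :
    (distinct x : L.Formula α).Realize v ↔ Function.Injective (v ∘ x) := by
  rw [distinct, realize_iInf']
  simp only [Formula.realize_not, realize_eqVar, Subtype.forall, Prod.forall]
  refine ⟨fun h i j hij => ?_, fun h i j hij e => hij.ne (h e)⟩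
  by_contra hne
  rcases lt_or_gt_of_ne hne with h' | h'
  · exact h i j h' hij
  · exact h j i h' hij.symm

theorem realize_psiEq {n : ℕ} : M ⊨ psiEq L n ↔ Nonempty (Fin n ≃ M) := by
  have hge : M ⊨ psiGe L n ↔ ∃ x : Fin n → M, Function.Injective x := by
    simp only [psiGe, Sentence.Realize, Formula.realize_iExs, realize_distinct]
    rfl
  have hle : M ⊨ psiLe L n ↔ ∃ x : Fin n → M, Function.Surjective x := by
    simp only [psiLe, Sentence.Realize, Formula.realize_iExs, Formula.realize_iAlls, realize_iSup',
      realize_eqVar]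
    refine exists_congr fun x => ⟨fun h a => ?_, fun h y => ?_⟩
    · obtain ⟨i, hi⟩ := h fun _ => a
      exact ⟨i, hi.symm⟩
    · obtain ⟨i, hi⟩ := h (y ())
      exact ⟨i, hi.symm⟩
  have hinf : M ⊨ psiEq L n ↔ M ⊨ psiGe L n ∧ M ⊨ psiLe L n := Formula.realize_inf
  rw [hinf, hge, hle]
  constructor
  · rintro ⟨⟨x, hx⟩, y, hy⟩
    have : Finite M := Finite.of_surjective y hy
    have h1 := Nat.card_le_card_of_injective x hx
    have h2 := Nat.card_le_card_of_surjective y hy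
    exact ⟨(Finite.equivFinOfCardEq (by simp at h1 h2; omega)).symm⟩
  · rintro ⟨e⟩
    exact ⟨⟨e, e.injective⟩, e, e.surjective⟩

end Realize

section Codes

variable {L : FirstOrder.Language.{0, 0}} [SymbolCoding L]

theorem formulaCode_equal {n : ℕ} (t u : L.Term (ℕ ⊕ Fin n)) :
    formulaCode (t.bdEqual u) = 4 * Nat.pair (termCode t) (termCode u) + 1 := by
  simp [Term.bdEqual, formulaCode]

theorem termCode_var {n : ℕ} (i : ℕ) :
    termCode (Term.var (Sum.inl i) : L.Term (ℕ ⊕ Fin n)) = 3 * i := by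
  simp [termCode]

theorem formulaCode_eqVar (x y : ℕ) :
    formulaCode (eqVar x y : L.Formula ℕ) = 4 * Nat.pair (3 * x) (3 * y) + 1 := by
  rw [show (eqVar x y : L.Formula ℕ) = (Term.var (Sum.inl x)).bdEqual (Term.var (Sum.inl y)) from
    rfl, formulaCode_equal, termCode_var, termCode_var]

end Codes

/-! ### The atoms of the signature of `T_=` -/

theorem sigP_term_eq_var (t : SigP.Term (ℕ ⊕ Fin 0)) : ∃ i, t = Term.var (Sum.inl i) := by
  rcases t with (i | i) | ⟨f, _⟩
  · exact ⟨i, rfl⟩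
  · exact i.elim0
  · exact Empty.elim f

theorem sigP_isAtomic_iff {φ : SigP.Formula ℕ} :
    BoundedFormula.IsAtomic φ ↔ (∃ i j, φ = eqVar i j) ∨ ∃ n, φ = atomP n := by
  constructor
  · intro h
    cases h with
    | equal t u =>
      obtain ⟨i, rfl⟩ := sigP_term_eq_var t
      obtain ⟨j, rfl⟩ := sigP_term_eq_var u
      exact Or.inl ⟨i, j, rfl⟩
    | rel R ts =>
      obtain ⟨n⟩ := R
      refine Or.inr ⟨n, ?_⟩
      rw [atomP, Relations.formula]
      congr 1
      funext i
      exact i.elim0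
  · rintro (⟨i, j, rfl⟩ | ⟨n, rfl⟩)
    · exact .equal _ _
    · exact .rel _ _

theorem formulaCode_atomP (n : ℕ+) :
    formulaCode (atomP n : SigP.Formula ℕ) = 4 * Nat.pair (Nat.pair 0 n) 0 + 2 := by
  simp only [atomP, Relations.formula, Relations.boundedFormula, formulaCode, List.ofFn_zero]
  rfl

/-- `P n` holds in `M`. -/
def HoldsP (M : Type) [SigP.Structure M] (n : ℕ+) : Prop :=
  Structure.RelMap (symP n) (default : Fin 0 → M)

@[simp]
theorem realize_atomP {M α : Type} [SigP.Structure M] {v : α → M} {n : ℕ+} :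
    (atomP n : SigP.Formula α).Realize v ↔ HoldsP M n := by
  rw [atomP, Formula.realize_rel, HoldsP]
  exact iff_of_eq (congrArg _ (Subsingleton.elim _ _))

theorem models_theoryEq_iff {M : Type} [SigP.Structure M] :
    M ⊨ theoryEq ↔ ∀ n : ℕ+, HoldsP M n → Nonempty (Fin n ≃ M) := by
  simp only [theoryEq, Theory.model_iff, Set.forall_mem_range]
  refine forall_congr' fun n => ?_
  rw [← realize_psiEq (L := SigP)]
  exact Formula.realize_imp.trans (imp_congr_left realize_atomP)

/-- The structure on `M` in which `P n` holds if `Q n`. -/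
@[reducible]
def structureP (M : Type) (Q : ℕ → Prop) : SigP.Structure M where
  funMap f := Empty.elim f
  RelMap R _ := Q R.index

/-! ### Decidability of `T_=` -/

/-- Test for the Gödel numbers of atoms of the signature of `T_=`. -/
def atomOkP (c : ℕ) : Bool :=
  if c % 4 = 1 then (c / 4).unpair.1 % 3 == 0 && (c / 4).unpair.2 % 3 == 0
  else if c % 4 = 2 then
    (c / 4).unpair.2 == 0 && ((c / 4).unpair.1.unpair.1 == 0 && !((c / 4).unpair.1.unpair.2 == 0))
  else c == 0

/-- The truth of atoms in an interpretation coded by the base-`(p.1 + 1)` digits of `p.2`: the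
variable with index `i` denotes the residue class modulo `m` of the digit with index `i`, and `P m`
is the only symbol that holds, where `m` is the digit with index `p.1 + 1`. -/
def evalAtomP (p : ℕ × ℕ) (c : ℕ) : Bool :=
  if c % 4 = 1 then
    digit (p.1 + 1) p.2 ((c / 4).unpair.1 / 3) % digit (p.1 + 1) p.2 (p.1 + 1) ==
      digit (p.1 + 1) p.2 ((c / 4).unpair.2 / 3) % digit (p.1 + 1) p.2 (p.1 + 1)
  else if c % 4 = 2 then (c / 4).unpair.1.unpair.2 == digit (p.1 + 1) p.2 (p.1 + 1)
  else false

theorem primrec_atomOkP : Primrec atomOkP := by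
  have hm : Primrec fun c : ℕ => c % 4 := Primrec.nat_mod.comp .id (.const 4)
  have hu : Primrec fun c : ℕ => (c / 4).unpair :=
    Primrec.unpair.comp (Primrec.nat_div.comp .id (.const 4))
  have huu : Primrec fun c : ℕ => (c / 4).unpair.1.unpair :=
    Primrec.unpair.comp (Primrec.fst.comp hu)
  refine Primrec.ite (Primrec.eq.comp hm (.const 1)) ?_
    (Primrec.ite (Primrec.eq.comp hm (.const 2)) ?_ (Primrec.beq.comp .id (.const 0)))
  · exact Primrec.and.comp
      (Primrec.beq.comp (Primrec.nat_mod.comp (Primrec.fst.comp hu) (.const 3)) (.const 0))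
      (Primrec.beq.comp (Primrec.nat_mod.comp (Primrec.snd.comp hu) (.const 3)) (.const 0))
  · exact Primrec.and.comp (Primrec.beq.comp (Primrec.snd.comp hu) (.const 0)) <| Primrec.and.comp
      (Primrec.beq.comp (Primrec.fst.comp huu) (.const 0))
      (Primrec.not.comp (Primrec.beq.comp (Primrec.snd.comp huu) (.const 0)))

theorem primrec_evalAtomP : Primrec₂ evalAtomP := by
  have hm : Primrec fun a : (ℕ × ℕ) × ℕ => a.2 % 4 := Primrec.nat_mod.comp .snd (.const 4)
  have hu : Primrec fun a : (ℕ × ℕ) × ℕ => (a.2 / 4).unpair :=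
    Primrec.unpair.comp (Primrec.nat_div.comp .snd (.const 4))
  have hB : Primrec fun a : (ℕ × ℕ) × ℕ => a.1.1 + 1 := Primrec.succ.comp (Primrec.fst.comp .fst)
  have hd {f : (ℕ × ℕ) × ℕ → ℕ} (hf : Primrec f) :
      Primrec fun a => digit (a.1.1 + 1) a.1.2 (f a) :=
    Primrec.digit hB (Primrec.snd.comp .fst) hf
  have hv {f : (ℕ × ℕ) × ℕ → ℕ} (hf : Primrec f) :
      Primrec fun a => digit (a.1.1 + 1) a.1.2 (f a / 3) % digit (a.1.1 + 1) a.1.2 (a.1.1 + 1) :=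
    Primrec.nat_mod.comp (hd (Primrec.nat_div.comp hf (.const 3))) (hd hB)
  refine Primrec.ite (Primrec.eq.comp hm (.const 1)) ?_
    (Primrec.ite (Primrec.eq.comp hm (.const 2)) ?_ (.const false))
  · exact Primrec.beq.comp (hv (Primrec.fst.comp hu)) (hv (Primrec.snd.comp hu))
  · exact Primrec.beq.comp (Primrec.snd.comp (Primrec.unpair.comp (Primrec.fst.comp hu))) (hd hB)

theorem atomOkP_iff {c : ℕ} (hc : c % 4 ≠ 3) :
    atomOkP c = true ↔
      c = 0 ∨ ∃ φ : SigP.Formula ℕ, BoundedFormula.IsAtomic φ ∧ formulaCode φ = c := by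
  constructor
  · intro h
    rw [atomOkP] at h
    split_ifs at h with h1 h2
    · right
      simp only [Bool.and_eq_true, beq_iff_eq] at h
      refine ⟨_, .equal (Term.var (Sum.inl ((c / 4).unpair.1 / 3)))
        (Term.var (Sum.inl ((c / 4).unpair.2 / 3))), ?_⟩
      rw [formulaCode_equal, termCode_var, termCode_var, Nat.mul_div_cancel' (by omega),
        Nat.mul_div_cancel' (by omega), Nat.pair_unpair]
      omega
    · right
      simp only [Bool.and_eq_true, beq_iff_eq, Bool.not_eq_true', beq_eq_false_iff_ne] at h
      obtain ⟨n, hn⟩ : ∃ n : ℕ+, (n : ℕ) = (c / 4).unpair.1.unpair.2 :=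
        ⟨⟨_, Nat.pos_of_ne_zero h.2.2⟩, rfl⟩
      refine ⟨atomP n, sigP_isAtomic_iff.2 (Or.inr ⟨_, rfl⟩), ?_⟩
      have h₁ : Nat.pair 0 n = (c / 4).unpair.1 := by rw [hn, ← h.2.1, Nat.pair_unpair]
      have h₂ : Nat.pair (c / 4).unpair.1 0 = c / 4 := by rw [← h.1, Nat.pair_unpair]
      rw [formulaCode_atomP, h₁, h₂]
      omega
    · exact Or.inl (by simpa using h)
  · rintro (rfl | ⟨φ, h, rfl⟩)
    · rfl
    · rcases sigP_isAtomic_iff.1 h with ⟨i, j, rfl⟩ | ⟨n, rfl⟩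
      · rw [formulaCode_eqVar, atomOkP, if_pos (by omega),
          show (4 * Nat.pair (3 * i) (3 * j) + 1) / 4 = Nat.pair (3 * i) (3 * j) by omega]
        simp
      · rw [formulaCode_atomP, atomOkP, if_neg (by omega), if_pos (by omega),
          show (4 * Nat.pair (Nat.pair 0 n) 0 + 2) / 4 = Nat.pair (Nat.pair 0 n) 0 by omega]
        simp

theorem evalAtomP_iff {M : Type} [SigP.Structure M] {v : ℕ → M} {B W N : ℕ}
    (hv : ∀ i ≤ N, ∀ j ≤ N, v i = v j ↔
      digit (B + 1) W i % digit (B + 1) W (B + 1) = digit (B + 1) W j % digit (B + 1) W (B + 1))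
    (hP : ∀ n : ℕ+, (n : ℕ) ≤ N → (HoldsP M n ↔ (n : ℕ) = digit (B + 1) W (B + 1)))
    {φ : SigP.Formula ℕ} (hφ : QF φ) (hN : formulaCode φ ≤ N) :
    codeFold (evalAtomP (B, W)) (fun x y => !x || y) (formulaCode φ) = true ↔ φ.Realize v := by
  refine codeFold_imp_iff v rfl (fun ψ hψ hN => ?_) hφ hN
  rcases sigP_isAtomic_iff.1 hψ with ⟨i, j, rfl⟩ | ⟨n, rfl⟩
  · rw [formulaCode_eqVar] at hN ⊢
    have := Nat.left_le_pair (3 * i) (3 * j)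
    have := Nat.right_le_pair (3 * i) (3 * j)
    rw [evalAtomP, if_pos (by omega),
      show (4 * Nat.pair (3 * i) (3 * j) + 1) / 4 = Nat.pair (3 * i) (3 * j) by omega,
      realize_eqVar, hv i (by omega) j (by omega)]
    simp
  · rw [formulaCode_atomP] at hN ⊢
    have := Nat.left_le_pair (Nat.pair 0 n) 0
    have := Nat.right_le_pair 0 (n : ℕ)
    rw [evalAtomP, if_neg (by omega), if_pos (by omega),
      show (4 * Nat.pair (Nat.pair 0 n) 0 + 2) / 4 = Nat.pair (Nat.pair 0 n) 0 by omega,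
      realize_atomP, hP n (by omega)]
    simp

/-- An interpretation is reduced to values modulo `m`, where `P m` is the true symbol. The modulus
`0` stands for the case that no symbol with index at most `c` is true; larger indices do not occur
in `φ`. -/
theorem satisfiable_theoryEq_iff {φ : SigP.Formula ℕ} (hφ : QF φ) :
    Satisfiable theoryEq φ ↔ ∃ W < (formulaCode φ + 1) ^ (2 * formulaCode φ + 2),
      codeFold (evalAtomP (formulaCode φ, W)) (fun x y => !x || y) (formulaCode φ) = true := by
  classical
  set c := formulaCode φ with hc
  constructor
  · rintro ⟨A, hA⟩
    have hmod := models_theoryEq_iff.1 A.models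
    obtain ⟨m, hm, h, hh, hv, hP⟩ : ∃ m ≤ c, ∃ h : ℕ → ℕ, (∀ i ≤ c, h i ≤ c) ∧
        (∀ i ≤ c, ∀ j ≤ c, A.val i = A.val j ↔ h i % m = h j % m) ∧
        ∀ n : ℕ+, (n : ℕ) ≤ c → (HoldsP A.Dom n ↔ (n : ℕ) = m) := by
      by_cases hex : ∃ n : ℕ+, (n : ℕ) ≤ c ∧ HoldsP A.Dom n
      · obtain ⟨n, hn, hPn⟩ := hex
        obtain ⟨e⟩ := hmod n hPn
        refine ⟨n, hn, fun i => e.symm (A.val i), fun i _ => (e.symm _).is_lt.le.trans hn, ?_, ?_⟩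
        · intro i _ j _
          rw [Nat.mod_eq_of_lt (e.symm _).is_lt, Nat.mod_eq_of_lt (e.symm _).is_lt, Fin.val_inj,
            e.symm.apply_eq_iff_eq]
        -- Two true symbols `P k` and `P n` give the domain `k` and `n` elements at once, hence `k =
        -- n`.
        · intro k _
          refine ⟨fun hk => ?_, fun hk => PNat.eq hk ▸ hPn⟩
          obtain ⟨e'⟩ := hmod k hk
          simpa using Fintype.card_congr (e'.trans e.symm)
      · have hex' : ∀ i, ∃ j, A.val j = A.val i := fun i => ⟨i, rfl⟩
        -- Reduction modulo `0` is the identity. Each variable is represented by the least index of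
        -- a variable with the same value, which is at most `i` and so a legal digit.
        refine ⟨0, Nat.zero_le _, fun i => Nat.find (hex' i),
          fun i hi => (Nat.find_min' (hex' i) rfl).trans hi, ?_, ?_⟩
        · intro i _ j _
          rw [Nat.mod_zero, Nat.mod_zero]
          refine ⟨fun hij => by simp only [hij], fun hij => ?_⟩
          exact (Nat.find_spec (hex' i)).symm.trans
            ((congrArg A.val hij).trans (Nat.find_spec (hex' j)))
        · intro n hn
          exact iff_of_false (fun hP => hex ⟨n, hn, hP⟩) n.ne_zero
    obtain ⟨W, hW, hd⟩ := exists_digits (B := c + 1) (2 * c + 2)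
      (fun i => if i ≤ c then h i else m) fun i _ => by
        have := hh i
        split_ifs <;> omega
    have hdm : digit (c + 1) W (c + 1) = m := by rw [hd _ (by omega), if_neg (by omega)]
    have hdi : ∀ i ≤ c, digit (c + 1) W i = h i := fun i hi => by
      rw [hd _ (by omega), if_pos hi]
    refine ⟨W, hW, (evalAtomP_iff (v := A.val) (N := c) ?_ ?_ hφ le_rfl).2 hA⟩
    · intro i hi j hj
      rw [hdm, hdi i hi, hdi j hj, hv i hi j hj]
    · rwa [hdm]
  · rintro ⟨W, -, hW⟩
    set m := digit (c + 1) W (c + 1) with hm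
    -- `ZMod m` treats both cases at once: it has `m` elements if `m > 0`, and for `m = 0` it is
    -- `ℤ`, where no `P n` holds since `n ≥ 1`.
    let _ : SigP.Structure (ZMod m) := structureP _ fun n => n = m
    refine ⟨⟨ZMod m, fun i => (digit (c + 1) W i : ZMod m), models_theoryEq_iff.2 fun n hn => ?_⟩,
      (evalAtomP_iff (N := c) (fun i _ j _ => ?_) (fun n _ => ?_) hφ le_rfl).1 hW⟩
    · have hn' : (n : ℕ) = m := hn
      have : NeZero m := ⟨hn' ▸ n.ne_zero⟩
      exact ⟨(Finite.equivFinOfCardEq (by rw [Nat.card_zmod, hn'])).symm⟩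
    · exact ZMod.natCast_eq_natCast_iff' _ _ _
    · exact Iff.rfl

theorem decidableTheory_theoryEq : DecidableTheory theoryEq :=
  decidableTheory_of_search primrec_atomOkP primrec_evalAtomP (fun _ => atomOkP_iff)
    fun _ => satisfiable_theoryEq_iff

theorem not_smooth_theoryEq : ¬ Smooth theoryEq := by
  intro h
  let _ : SigP.Structure Unit := structureP _ fun n => n = 1
  let A : Interp theoryEq := ⟨Unit, fun _ => (), models_theoryEq_iff.2 fun n hn => by
    have hn' : (n : ℕ) = 1 := hn
    rw [hn']
    exact ⟨finOneEquiv.trans (Equiv.refl _)⟩⟩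
  obtain ⟨B, hB, hcard⟩ := h (atomP 1) (BoundedFormula.IsAtomic.isQF (.rel _ _)) A
    (realize_atomP.2 rfl) 2 (by
      change Cardinal.mk Unit < 2
      rw [Cardinal.mk_fintype]
      norm_num)
  obtain ⟨e⟩ := models_theoryEq_iff.1 B.models 1 (realize_atomP.1 hB)
  have := Cardinal.mk_congr e
  rw [hcard] at this
  simp at this

/-! ### Terms of the signature of `T_f` -/

/-- The meaning of `s`. -/
def sMap {M : Type} [SigS.Structure M] (x : M) : M := Structure.funMap symS ![x]

/-- The structure on `M` in which `s` denotes `g`. -/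
@[reducible]
def structureS {M : Type} (g : M → M) : SigS.Structure M where
  funMap {k} f x := match k, f, x with | _, .s, x => g (x 0)
  RelMap R := Empty.elim R

@[simp]
theorem realize_apply_symS {M α : Type} [SigS.Structure M] {v : α → M} {t : SigS.Term α} :
    (symS.apply₁ t).realize v = sMap (t.realize v) := by
  simp only [Functions.apply₁, Term.realize, sMap]
  congr 1
  funext i
  fin_cases i
  rfl

theorem sigS_term_induction {P : SigS.Term (ℕ ⊕ Fin 0) → Prop}
    (var : ∀ i, P (Term.var (Sum.inl i))) (app : ∀ t, P t → P (symS.apply₁ t)) :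
    ∀ t, P t
  | .var (Sum.inl i) => var i
  | .var (Sum.inr i) => i.elim0
  | .func .s ts => by
    have : Term.func SFunc.s ts = symS.apply₁ (ts 0) := by
      rw [Functions.apply₁]
      congr 1
      funext i
      fin_cases i
      rfl
    rw [this]
    exact app _ (sigS_term_induction var app (ts 0))

/-- The Gödel number of `s t`, where `a` is the Gödel number of `t`. -/
def appCode (a : ℕ) : ℕ := 3 * Nat.pair (Nat.pair 1 0) (Nat.pair a 0 + 1) + 2

theorem termCode_apply_symS (t : SigS.Term (ℕ ⊕ Fin 0)) :
    termCode (symS.apply₁ t) = appCode (termCode t) := by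
  simp only [Functions.apply₁, termCode, appCode, List.ofFn_succ, List.ofFn_zero,
    Encodable.encode_list_cons, Encodable.encode_list_nil, Encodable.encode_nat]
  rfl

theorem primrec_appCode : Primrec appCode :=
  Primrec.nat_add.comp (Primrec.nat_mul.comp (.const 3) (Primrec₂.natPair.comp (.const _)
    (Primrec.succ.comp (Primrec₂.natPair.comp .id (.const 0))))) (.const 2)

theorem appCode_mod (a : ℕ) : appCode a % 3 = 2 := by
  rw [appCode]; omega

theorem appCode_div (a : ℕ) : appCode a / 3 = Nat.pair (Nat.pair 1 0) (Nat.pair a 0 + 1) := by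
  rw [appCode]; omega

@[simp]
theorem argCode_appCode (a : ℕ) : argCode (appCode a) = a := by
  simp [argCode, appCode_div]

theorem lt_appCode (a : ℕ) : a < appCode a := by
  simpa using argCode_lt (appCode_mod a)

theorem termFold_appCode {σ : Type} (leaf : ℕ → σ) (node : ℕ → σ → σ) (a : ℕ) :
    termFold leaf node (appCode a) = node (appCode a) (termFold leaf node a) := by
  rw [termFold, dif_pos (appCode_mod a), argCode_appCode]

theorem termFold_leaf {σ : Type} (leaf : ℕ → σ) (node : ℕ → σ → σ) {t : ℕ} (h : t % 3 ≠ 2) :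
    termFold leaf node t = leaf t := by
  rw [termFold, dif_neg h]

/-- Test for Gödel numbers of terms of the signature of `T_f`. -/
def termOkS : ℕ → Bool :=
  termFold (fun t => t % 3 == 0) fun t b => b && t == appCode (argCode t)

/-- `argCode` discards the symbol number and the rest of the argument list, so a compound code is
accepted only if encoding its argument again returns the same number. The leaf test excludes the
codes of bound variables. -/
theorem termOkS_iff (c : ℕ) :
    termOkS c = true ↔ ∃ t : SigS.Term (ℕ ⊕ Fin 0), termCode t = c := by
  constructor
  · induction c using Nat.strong_induction_on with
    | _ c ih =>
      intro h
      by_cases hc : c % 3 = 2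
      · rw [termOkS, termFold, dif_pos hc, Bool.and_eq_true, beq_iff_eq] at h
        obtain ⟨t, ht⟩ := ih _ (argCode_lt hc) h.1
        exact ⟨symS.apply₁ t, by rw [termCode_apply_symS, ht, ← h.2]⟩
      · rw [termOkS, termFold_leaf _ _ hc, beq_iff_eq] at h
        exact ⟨Term.var (Sum.inl (c / 3)), by rw [termCode_var]; omega⟩
  · rintro ⟨t, rfl⟩
    induction t using sigS_term_induction with
    | var i => rw [termCode_var, termOkS, termFold_leaf _ _ (by omega)]; simp
    | app t ih => rw [termCode_apply_symS, termOkS, termFold_appCode, ← termOkS, ih]; simp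

/-- Test for the Gödel numbers of atoms of the signature of `T_f`. -/
def atomOkS (c : ℕ) : Bool :=
  if c % 4 = 1 then termOkS (c / 4).unpair.1 && termOkS (c / 4).unpair.2 else c == 0

theorem atomOkS_iff (c : ℕ) :
    atomOkS c = true ↔
      c = 0 ∨ ∃ φ : SigS.Formula ℕ, BoundedFormula.IsAtomic φ ∧ formulaCode φ = c := by
  constructor
  · intro h
    rw [atomOkS] at h
    split_ifs at h with h1
    · right
      rw [Bool.and_eq_true, termOkS_iff, termOkS_iff] at h
      obtain ⟨⟨t, ht⟩, u, hu⟩ := h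
      refine ⟨t.bdEqual u, .equal t u, ?_⟩
      rw [formulaCode_equal, ht, hu, Nat.pair_unpair]
      omega
    · exact Or.inl (by simpa using h)
  · rintro (rfl | ⟨φ, h, rfl⟩)
    · rfl
    · cases h with
      | rel R => exact Empty.elim R
      | equal t u =>
        rw [formulaCode_equal, atomOkS, if_pos (by omega), show
          (4 * Nat.pair (termCode t) (termCode u) + 1) / 4 = Nat.pair (termCode t) (termCode u) by
            omega, Nat.unpair_pair, Bool.and_eq_true, termOkS_iff, termOkS_iff]
        exact ⟨⟨t, rfl⟩, u, rfl⟩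

/-- The value of a term in the interpretation over the natural numbers coded by the
base-`(p.1 + 1)` digits of `p.2`: those below `p.1 + 1` are the values of the variables, the
others are the values of `s`. -/
def evalTermS (p : ℕ × ℕ) : ℕ → ℕ :=
  termFold (fun t => digit (p.1 + 1) p.2 (t / 3)) fun _ x => digit (p.1 + 1) p.2 (p.1 + 1 + x)

/-- The truth of atoms in the interpretation underlying `evalTermS p`. -/
def evalAtomS (p : ℕ × ℕ) (c : ℕ) : Bool :=
  if c % 4 = 1 then evalTermS p (c / 4).unpair.1 == evalTermS p (c / 4).unpair.2 else false

theorem primrec_atomOkS : Primrec atomOkS := by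
  have hok : Primrec termOkS :=
    (primrec_termFold (α := Unit) (leaf := fun _ t => t % 3 == 0)
      (node := fun _ p => p.2 && p.1 == appCode (argCode p.1))
      (Primrec.beq.comp (Primrec.nat_mod.comp .snd (.const 3)) (.const 0))
      (Primrec.and.comp (Primrec.snd.comp .snd) (Primrec.beq.comp (Primrec.fst.comp .snd)
        (primrec_appCode.comp (primrec_argCode.comp (Primrec.fst.comp .snd)))))).comp
          (Primrec.const ()) Primrec.id
  have hu : Primrec fun c : ℕ => (c / 4).unpair :=
    Primrec.unpair.comp (Primrec.nat_div.comp .id (.const 4))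
  exact Primrec.ite (Primrec.eq.comp (Primrec.nat_mod.comp .id (.const 4)) (.const 1))
    (Primrec.and.comp (hok.comp (Primrec.fst.comp hu)) (hok.comp (Primrec.snd.comp hu)))
    (Primrec.beq.comp .id (.const 0))

theorem primrec_evalAtomS : Primrec₂ evalAtomS := by
  have hterm : Primrec₂ evalTermS := by
    have hB : Primrec fun p : ℕ × ℕ => p.1 + 1 := Primrec.succ.comp .fst
    refine primrec_termFold (leaf := fun (p : ℕ × ℕ) t => digit (p.1 + 1) p.2 (t / 3))
      (node := fun (p : ℕ × ℕ) x => digit (p.1 + 1) p.2 (p.1 + 1 + x.2)) ?_ ?_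
    · exact Primrec.digit (hB.comp .fst) (Primrec.snd.comp .fst)
        (Primrec.nat_div.comp .snd (.const 3))
    · exact Primrec.digit (hB.comp .fst) (Primrec.snd.comp .fst)
        (Primrec.nat_add.comp (hB.comp .fst) (Primrec.snd.comp .snd))
  have hu : Primrec fun a : (ℕ × ℕ) × ℕ => (a.2 / 4).unpair :=
    Primrec.unpair.comp (Primrec.nat_div.comp .snd (.const 4))
  exact Primrec.ite (Primrec.eq.comp (Primrec.nat_mod.comp .snd (.const 4)) (.const 1))
    (Primrec.beq.comp (hterm.comp .fst (Primrec.fst.comp hu))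
      (hterm.comp .fst (Primrec.snd.comp hu))) (.const false)

theorem evalAtomS_iff {M : Type} [SigS.Structure M] {v : ℕ → M} {p : ℕ × ℕ} {N : ℕ}
    (h : ∀ t u : SigS.Term (ℕ ⊕ Fin 0), termCode t ≤ N → termCode u ≤ N →
      (t.realize (Sum.elim v default) = u.realize (Sum.elim v default) ↔
        evalTermS p (termCode t) = evalTermS p (termCode u)))
    {φ : SigS.Formula ℕ} (hφ : QF φ) (hN : formulaCode φ ≤ N) :
    codeFold (evalAtomS p) (fun x y => !x || y) (formulaCode φ) = true ↔ φ.Realize v := by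
  refine codeFold_imp_iff v rfl (fun ψ hψ hN => ?_) hφ hN
  cases hψ with
  | rel R => exact Empty.elim R
  | equal t u =>
    rw [formulaCode_equal] at hN ⊢
    have := Nat.left_le_pair (termCode t) (termCode u)
    have := Nat.right_le_pair (termCode t) (termCode u)
    rw [evalAtomS, if_pos (by omega), show
      (4 * Nat.pair (termCode t) (termCode u) + 1) / 4 = Nat.pair (termCode t) (termCode u) by
        omega, Nat.unpair_pair, beq_iff_eq, Formula.Realize, BoundedFormula.realize_bdEqual,
      h t u (by omega) (by omega)]

/-! ### Cardinality axioms on fixed points -/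

section Models

variable {M : Type} [SigS.Structure M]

/-- The set of fixed points of `s` (for `b = true`), respectively its complement. -/
def fixSet (M : Type) [SigS.Structure M] (b : Bool) : Set M := {x | sMap x = x ↔ b = true}

@[simp]
theorem realize_fixLit {α : Type} {v : α → M} {b : Bool} {x : α} :
    (fixLit b x).Realize v ↔ v x ∈ fixSet M b := by
  cases b <;> simp [fixLit, fixSet, sMap]

theorem realize_psiFixGe {b : Bool} {n : ℕ} :
    M ⊨ psiFixGe b n ↔ Nonempty (Fin n ↪ fixSet M b) := by
  simp only [psiFixGe, Sentence.Realize, Formula.realize_iExs, Formula.realize_inf,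
    realize_distinct, realize_iInf', realize_fixLit]
  constructor
  · rintro ⟨x, hx, hb⟩
    exact ⟨fun i => ⟨x i, hb i⟩, fun i j hij => hx (congrArg Subtype.val hij)⟩
  · rintro ⟨e⟩
    exact ⟨fun i => e i, Subtype.val_injective.comp e.injective, fun i => (e i).2⟩

theorem realize_psiFixEq {b : Bool} {n : ℕ} :
    M ⊨ psiFixEq b n ↔ Nonempty (Fin n ≃ fixSet M b) := by
  simp only [psiFixEq, Sentence.Realize, Formula.realize_iExs, Formula.realize_iAlls,
    Formula.realize_inf, Formula.realize_imp, realize_distinct, realize_iInf', realize_iSup',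
    realize_fixLit, realize_eqVar]
  constructor
  · rintro ⟨x, hx, hb, h⟩
    refine ⟨Equiv.ofBijective (fun i => ⟨x i, hb i⟩)
      ⟨fun i j hij => hx (congrArg Subtype.val hij), fun y => ?_⟩⟩
    obtain ⟨i, hi⟩ := h (fun _ => y) y.2
    exact ⟨i, Subtype.ext hi.symm⟩
  · rintro ⟨e⟩
    refine ⟨fun i => e i, Subtype.val_injective.comp e.injective, fun i => (e i).2, fun y hy => ?_⟩
    obtain ⟨i, hi⟩ := e.surjective ⟨y (), hy⟩
    exact ⟨i, (congrArg Subtype.val hi).symm⟩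

theorem models_theoryF_iff {f : ℕ → Bool} : M ⊨ theoryF f ↔ ∀ k, 1 ≤ k →
    (∀ b, Nonempty (Fin (count f b k) ↪ fixSet M b)) ∨
      ∃ i < k, ∀ b, Nonempty (Fin (count f b (i + 1)) ≃ fixSet M b) := by
  have h (k : ℕ) : M ⊨ axiomF f k ↔ (∀ b, Nonempty (Fin (count f b k) ↪ fixSet M b)) ∨
      ∃ i < k, ∀ b, Nonempty (Fin (count f b (i + 1)) ≃ fixSet M b) := by
    rw [axiomF, Sentence.Realize, Formula.realize_sup, realize_iSup']
    simp only [Formula.realize_inf]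
    rw [← Sentence.Realize, ← Sentence.Realize, realize_psiFixGe, realize_psiFixGe,
      Bool.forall_bool, and_comm]
    refine or_congr_right ⟨?_, ?_⟩
    · rintro ⟨i, h1, h2⟩
      exact ⟨i, i.2, Bool.forall_bool.2 ⟨realize_psiFixEq.1 h2, realize_psiFixEq.1 h1⟩⟩
    · rintro ⟨i, hi, h⟩
      exact ⟨⟨i, hi⟩, realize_psiFixEq.2 (h true), realize_psiFixEq.2 (h false)⟩
  simp only [theoryF, Theory.model_iff]
  constructor
  · intro H k hk
    exact (h k).1 (H _ ⟨k, hk, rfl⟩)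
  · rintro H _ ⟨k, hk, rfl⟩
    exact (h k).2 (H k hk)

end Models

/-! ### Decidability of `T_f` -/

/-- The right-hand side does not mention `f`: it says that `φ` holds in some structure with a unary
function. Values of terms are replaced by the least code with that value, and the coded structure is
then padded to a model of every axiom. -/
theorem satisfiable_theoryF_iff {f : ℕ → Bool} {φ : SigS.Formula ℕ} (hφ : QF φ) :
    Satisfiable (theoryF f) φ ↔ ∃ W < (formulaCode φ + 1) ^ (2 * formulaCode φ + 2),
      codeFold (evalAtomS (formulaCode φ, W)) (fun x y => !x || y) (formulaCode φ) = true := by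
  classical
  set c := formulaCode φ with hc
  constructor
  · rintro ⟨A, hA⟩
    -- Evaluation is extended to all numbers, whether or not they code terms, so that least
    -- representatives `r n ≤ n` exist without further conditions.
    set ev : ℕ → A.Dom := termFold (fun t => A.val (t / 3)) fun _ x => sMap x with hev
    have hevt (t : SigS.Term (ℕ ⊕ Fin 0)) :
        ev (termCode t) = t.realize (Sum.elim A.val default) := by
      induction t using sigS_term_induction with
      | var i => rw [termCode_var, hev, termFold_leaf _ _ (by omega)]; simp
      | app t ih => rw [termCode_apply_symS, hev, termFold_appCode, ← hev, ih, realize_apply_symS]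
    have happ (a : ℕ) : ev (appCode a) = sMap (ev a) := termFold_appCode _ _ a
    have hex (n : ℕ) : ∃ j, ev j = ev n := ⟨n, rfl⟩
    obtain ⟨r, hr, hrle, hrcongr⟩ : ∃ r : ℕ → ℕ, (∀ n, ev (r n) = ev n) ∧ (∀ n, r n ≤ n) ∧
        ∀ m n, ev m = ev n → r m = r n :=
      ⟨fun n => Nat.find (hex n), fun n => Nat.find_spec (hex n),
        fun n => Nat.find_min' (hex n) rfl, fun m n h => by simp only [h]⟩
    -- Digit `i ≤ c` is the value of the variable `i`, whose code is `3 * i`; digit `c + 1 + x` is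
    -- the value of `s` at the representative `x`. The minimum only keeps irrelevant entries below
    -- the base, since representatives of codes up to `c` are at most `c`.
    obtain ⟨W, hW, hd⟩ := exists_digits (B := c + 1) (2 * c + 2)
      (fun i => if i ≤ c then min c (r (3 * i)) else min c (r (appCode (i - (c + 1)))))
      fun i _ => by
        split_ifs <;> omega
    have heval (t : SigS.Term (ℕ ⊕ Fin 0)) :
        termCode t ≤ c → evalTermS (c, W) (termCode t) = r (termCode t) := by
      induction t using sigS_term_induction with
      | var i =>
        intro ht
        rw [termCode_var] at ht ⊢
        have := hrle (3 * i)
        rw [evalTermS, termFold_leaf _ _ (by omega), Nat.mul_div_cancel_left _ (by omega),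
          hd i (by omega), if_pos (by omega)]
        omega
      | app t ih =>
        intro ht
        rw [termCode_apply_symS] at ht ⊢
        have := lt_appCode (termCode t)
        have := hrle (termCode t)
        have := hrle (appCode (termCode t))
        -- The value of `s` depends only on the value of its argument, so the table may be indexed
        -- by representatives.
        have hrr : r (appCode (r (termCode t))) = r (appCode (termCode t)) :=
          hrcongr _ _ (by rw [happ, happ, hr])
        rw [evalTermS, termFold_appCode, ← evalTermS, ih (by omega), hd _ (by omega),
          if_neg (by omega), Nat.add_sub_cancel_left, hrr]
        omega
    refine ⟨W, hW, (evalAtomS_iff (v := A.val) (N := c) (fun t u ht hu => ?_) hφ le_rfl).2 hA⟩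
    rw [heval t ht, heval u hu, ← hevt, ← hevt]
    refine ⟨hrcongr _ _, fun h => ?_⟩
    rw [← hr, h, hr]
  · rintro ⟨W, -, hW⟩
    -- The left summand carries the coded structure and is closed under `s`. The right summand adds
    -- the fixed points `(n, true)` and the non-fixed points `(n, false) ↦ (n + 1, false)`,
    -- infinitely many of each.
    let g : ℕ ⊕ ℕ × Bool → ℕ ⊕ ℕ × Bool :=
      Sum.elim (fun n => Sum.inl (digit (c + 1) W (c + 1 + n)))
        fun p => Sum.inr (if p.2 then p.1 else p.1 + 1, p.2)
    let _ : SigS.Structure (ℕ ⊕ ℕ × Bool) := structureS g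
    let v : ℕ → ℕ ⊕ ℕ × Bool := fun i => Sum.inl (digit (c + 1) W i)
    have heval (xs : Fin 0 → ℕ ⊕ ℕ × Bool) (t : SigS.Term (ℕ ⊕ Fin 0)) :
        t.realize (Sum.elim v xs) = Sum.inl (evalTermS (c, W) (termCode t)) := by
      induction t using sigS_term_induction with
      | var i =>
        rw [termCode_var, evalTermS, termFold_leaf _ _ (by omega)]
        simp [v]
      | app t ih =>
        rw [termCode_apply_symS, evalTermS, termFold_appCode, ← evalTermS, realize_apply_symS, ih]
        rfl
    refine ⟨⟨ℕ ⊕ ℕ × Bool, v, models_theoryF_iff.2 fun k _ => Or.inl fun b => ?_⟩,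
      (evalAtomS_iff (N := c) (fun t u _ _ => ?_) hφ le_rfl).1 hW⟩
    · refine ⟨⟨fun n => ⟨Sum.inr (n, b), ?_⟩, fun m n h => ?_⟩⟩
      · change g (Sum.inr (↑n, b)) = Sum.inr (↑n, b) ↔ b = true
        cases b <;> simp [g]
      · simpa [Fin.ext_iff] using h
    · exact (iff_of_eq (congrArg₂ Eq (heval _ t) (heval _ u))).trans (by rw [Sum.inl.injEq])

theorem decidableTheory_theoryF (f : ℕ → Bool) : DecidableTheory (theoryF f) :=
  decidableTheory_of_search primrec_atomOkS primrec_evalAtomS (fun c _ => atomOkS_iff c)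
    fun _ => satisfiable_theoryF_iff

/-! ### Variables -/

section Vars

variable {L : FirstOrder.Language.{0, 0}}

theorem vars_not (φ : L.Formula ℕ) : vars (∼φ) = vars φ := by
  simp [vars]

theorem vars_inf (φ ψ : L.Formula ℕ) : vars (φ ⊓ ψ) = vars φ ∪ vars ψ := by
  simp [vars, Min.min]

theorem vars_sup (φ ψ : L.Formula ℕ) : vars (φ ⊔ ψ) = vars φ ∪ vars ψ := by
  simp [vars, Max.max]

theorem vars_eqVar (x y : ℕ) : vars (eqVar x y : L.Formula ℕ) = {x, y} := rfl

theorem mem_vars_bigAnd {l : List (L.Formula ℕ)} {x : ℕ} :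
    x ∈ vars (bigAnd l) ↔ ∃ φ ∈ l, x ∈ vars φ := by
  induction l with
  | nil => simp [bigAnd, vars, Top.top, Bot.bot]
  | cons φ l ih =>
    rw [bigAnd, List.foldr_cons, ← bigAnd, vars_inf, Finset.mem_union, ih]
    simp

theorem mem_vars_bigOr {l : List (L.Formula ℕ)} {x : ℕ} :
    x ∈ vars (bigOr l) ↔ ∃ φ ∈ l, x ∈ vars φ := by
  induction l with
  | nil => simp [bigOr, vars, Bot.bot]
  | cons φ l ih =>
    rw [bigOr, List.foldr_cons, ← bigOr, vars_sup, Finset.mem_union, ih]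
    simp

theorem notMem_vars_of_freshIndex_le {φ : L.Formula ℕ} {x : ℕ} (h : freshIndex φ ≤ x) :
    x ∉ vars φ := fun hx => by
  have : x.succ ≤ freshIndex φ := Finset.le_sup (f := Nat.succ) hx
  omega

theorem qf_bigAnd {l : List (L.Formula ℕ)} (h : ∀ φ ∈ l, QF φ) : QF (bigAnd l) := by
  induction l with
  | nil => exact BoundedFormula.IsQF.top
  | cons φ l ih =>
    exact (h φ (by simp)).inf (ih fun ψ hψ => h ψ (by simp [hψ]))

theorem qf_bigOr {l : List (L.Formula ℕ)} (h : ∀ φ ∈ l, QF φ) : QF (bigOr l) := by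
  induction l with
  | nil => exact BoundedFormula.isQF_bot
  | cons φ l ih =>
    exact (h φ (by simp)).sup (ih fun ψ hψ => h ψ (by simp [hψ]))

theorem qf_eqVar (x y : ℕ) : QF (eqVar x y : L.Formula ℕ) :=
  BoundedFormula.IsAtomic.isQF (.equal _ _)

/-! ### Disjunctive normal forms -/

theorem realize_litToFormula {M : Type} [L.Structure M] {v : ℕ → M} {b : Bool} {φ : L.Formula ℕ} :
    (Lit.toFormula (b, φ)).Realize v ↔ (φ.Realize v ↔ b = true) := by
  cases b <;> simp [Lit.toFormula]

theorem dnf_atomic {φ : L.Formula ℕ} (h : BoundedFormula.IsAtomic φ) (b : Bool) :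
    dnf φ b = [ [(b, φ)] ] := by
  cases h <;> cases b <;> simp [dnf, Term.bdEqual, Relations.boundedFormula]

/-- Both signs are needed in the induction, because a normal form of an implication uses one of the
negated premise. -/
theorem exists_dnf_realize_iff {M : Type} [L.Structure M] {v : ℕ → M} {φ : L.Formula ℕ}
    (hφ : QF φ) (b : Bool) :
    (∃ c ∈ dnf φ b, ∀ l ∈ c, (Lit.toFormula l).Realize v) ↔ (φ.Realize v ↔ b = true) := by
  induction hφ generalizing b with
  | falsum =>
    have : ¬ Formula.Realize (BoundedFormula.falsum : L.Formula ℕ) v := id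
    cases b <;> simp [dnf, this]
  | of_isAtomic h =>
    cases b <;> simp [dnf_atomic h, realize_litToFormula]
  | @imp φ ψ _ _ h₁ h₂ =>
    have h₁ := h₁ (!b)
    have h₂ := h₂ b
    rw [Formula.realize_imp]
    cases b with
    | true =>
      simp only [dnf, List.mem_append, or_and_right, exists_or]
      simp only [Bool.not_true] at h₁
      rw [h₁, h₂]
      simp only [Bool.false_eq_true]
      tauto
    | false =>
      simp only [Bool.not_false] at h₁
      simp only [Bool.false_eq_true, iff_false, iff_true] at h₁ h₂ ⊢
      rw [Classical.not_imp, ← h₁, ← h₂]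
      simp only [dnf, List.mem_flatMap, List.mem_map]
      constructor
      · rintro ⟨_, ⟨c, hc, d, hd, rfl⟩, h⟩
        exact ⟨⟨c, hc, fun l hl => h l (List.mem_append_left _ hl)⟩,
          d, hd, fun l hl => h l (List.mem_append_right _ hl)⟩
      · rintro ⟨⟨c, hc, h⟩, d, hd, h'⟩
        refine ⟨_, ⟨c, hc, d, hd, rfl⟩, fun l hl => ?_⟩
        rcases List.mem_append.1 hl with hl | hl
        exacts [h l hl, h' l hl]

theorem dnf_literals {φ : L.Formula ℕ} (hφ : QF φ) (b : Bool) :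
    ∀ c ∈ dnf φ b, ∀ l ∈ c, BoundedFormula.IsAtomic l.2 ∧ vars l.2 ⊆ vars φ := by
  induction hφ generalizing b with
  | falsum => cases b <;> simp [dnf]
  | of_isAtomic h => simp [dnf_atomic h, h]
  | @imp φ ψ _ _ h₁ h₂ =>
    have hl := Finset.subset_union_left (s₁ := vars φ) (s₂ := vars ψ)
    have hr := Finset.subset_union_right (s₁ := vars φ) (s₂ := vars ψ)
    intro c hc l hlc
    change _ ∧ vars l.2 ⊆ vars φ ∪ vars ψ
    cases b with
    | true =>
      rw [dnf, List.mem_append] at hc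
      rcases hc with hc | hc
      · exact (h₁ _ c hc l hlc).imp_right fun h => h.trans hl
      · exact (h₂ _ c hc l hlc).imp_right fun h => h.trans hr
    | false =>
      simp only [dnf, List.mem_flatMap, List.mem_map] at hc
      obtain ⟨c, hc, d, hd, rfl⟩ := hc
      rcases List.mem_append.1 hlc with hlc | hlc
      · exact (h₁ _ c hc l hlc).imp_right fun h => h.trans hl
      · exact (h₂ _ d hd l hlc).imp_right fun h => h.trans hr

end Vars

/-! ### Transfer between interpretations -/

/-- An atom sees only the equalities between its variables or the truth of one `P n`, so its truth
can be carried to a different domain. -/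
theorem realize_congr_of_isAtomic {M N : Type} [SigP.Structure M] [SigP.Structure N] {v : ℕ → M}
    {w : ℕ → N} {φ : SigP.Formula ℕ} (hφ : BoundedFormula.IsAtomic φ)
    (hv : ∀ x ∈ vars φ, ∀ y ∈ vars φ, (v x = v y ↔ w x = w y))
    (hP : ∀ n, φ = atomP n → (HoldsP M n ↔ HoldsP N n)) : φ.Realize v ↔ φ.Realize w := by
  rcases sigP_isAtomic_iff.1 hφ with ⟨i, j, rfl⟩ | ⟨n, rfl⟩
  · rw [realize_eqVar, realize_eqVar]
    exact hv i (by simp [vars_eqVar]) j (by simp [vars_eqVar])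
  · rw [realize_atomP, realize_atomP, hP n rfl]

theorem realize_congr_of_qf {M : Type} [SigP.Structure M] {v w : ℕ → M} {φ : SigP.Formula ℕ}
    (hφ : QF φ) (h : ∀ x ∈ vars φ, v x = w x) : φ.Realize v ↔ φ.Realize w := by
  induction hφ with
  | falsum => exact Iff.rfl
  | of_isAtomic hφ =>
    exact realize_congr_of_isAtomic hφ (fun x hx y hy => by rw [h x hx, h y hy]) fun _ _ => Iff.rfl
  | @imp φ ψ _ _ h₁ h₂ =>
    rw [Formula.realize_imp, Formula.realize_imp,
      h₁ fun x hx => h x (Finset.mem_union_left _ hx),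
      h₂ fun x hx => h x (Finset.mem_union_right _ hx)]

/-! ### The witness of a cube -/

theorem posIndex_atomP (n : ℕ+) : Lit.posIndex (true, atomP n) = n := rfl

theorem exists_of_posIndex_pos {l : Lit SigP} (hl : BoundedFormula.IsAtomic l.2)
    (h : 0 < Lit.posIndex l) : ∃ n : ℕ+, l = (true, atomP n) := by
  obtain ⟨b, φ⟩ := l
  rcases sigP_isAtomic_iff.1 hl with ⟨i, j, h'⟩ | ⟨n, h'⟩ <;> dsimp only at h' <;> subst h'
  · cases b <;> exact absurd h (lt_irrefl 0)
  · cases b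
    · exact absurd h (lt_irrefl 0)
    · exact ⟨n, rfl⟩

theorem posIndex_le_maxPosIndex {c : List (Lit SigP)} {l : Lit SigP} (hl : l ∈ c) :
    Lit.posIndex l ≤ maxPosIndex c := by
  induction c with
  | nil => simp at hl
  | cons a c ih =>
    rcases List.mem_cons.1 hl with rfl | hl
    · exact le_max_left _ _
    · exact (ih hl).trans (le_max_right _ _)

theorem exists_posIndex_eq {c : List (Lit SigP)} (h : 0 < maxPosIndex c) :
    ∃ l ∈ c, Lit.posIndex l = maxPosIndex c := by
  induction c with
  | nil => exact absurd h (lt_irrefl 0)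
  | cons a c ih =>
    have hmax : maxPosIndex (a :: c) = max (Lit.posIndex a) (maxPosIndex c) := rfl
    rcases le_total (maxPosIndex c) (Lit.posIndex a) with hle | hle
    · exact ⟨a, by simp, by rw [hmax, max_eq_left hle]⟩
    · rw [hmax, max_eq_right hle] at h ⊢
      obtain ⟨l, hl, h'⟩ := ih h
      exact ⟨l, by simp [hl], h'⟩

theorem nonempty_equiv_of_cube {M : Type} [SigP.Structure M] (hM : M ⊨ theoryEq) {v : ℕ → M}
    {c : List (Lit SigP)} (hc : ∀ l ∈ c, BoundedFormula.IsAtomic l.2)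
    (hv : ∀ l ∈ c, (Lit.toFormula l).Realize v) (h : 0 < maxPosIndex c) :
    Nonempty (Fin (maxPosIndex c) ≃ M) := by
  obtain ⟨l, hl, hlc⟩ := exists_posIndex_eq h
  obtain ⟨n, rfl⟩ := exists_of_posIndex_pos (hc l hl) (by omega)
  rw [← hlc, posIndex_atomP]
  exact models_theoryEq_iff.1 hM n (realize_atomP.1 (hv _ hl))

theorem realize_cubeWit {M : Type} [SigP.Structure M] {v : ℕ → M} {k : ℕ} {c : List (Lit SigP)} :
    (cubeWit k c).Realize v ↔ (∀ l ∈ c, (Lit.toFormula l).Realize v) ∧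
      ∀ i j, i < j → j < maxPosIndex c → v (k + i) ≠ v (k + j) := by
  rw [cubeWit, Formula.realize_inf, Formula.realize_inf, realize_bigAnd, realize_bigAnd]
  simp only [List.mem_map, forall_exists_index, and_imp, forall_apply_eq_imp_iff₂, realize_eqVar,
    true_and, List.mem_flatMap, List.mem_range]
  refine and_congr_right' ⟨fun h i j hij hj => ?_, ?_⟩
  · have := h _ j hj i hij rfl
    rwa [Formula.realize_not, realize_eqVar] at this
  · rintro h _ j hj i hij rfl
    rw [Formula.realize_not, realize_eqVar]
    exact h i j hij hj

/-- This is the role of the conjunct `w₀ = w₀`: a fresh variable occurs even when there are no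
inequalities. It keeps the reduced domain nonempty and names the single element when `n = 1`. -/
theorem self_mem_vars_cubeWit (k : ℕ) (c : List (Lit SigP)) : k ∈ vars (cubeWit k c) := by
  rw [cubeWit, vars_inf, vars_inf, vars_eqVar]
  simp

theorem add_mem_vars_cubeWit {k i : ℕ} {c : List (Lit SigP)} (hi : i < maxPosIndex c) :
    k + i ∈ vars (cubeWit k c) := by
  rcases Nat.eq_zero_or_pos i with rfl | hpos
  · exact self_mem_vars_cubeWit k c
  · rw [cubeWit, vars_inf, vars_inf]
    refine Finset.mem_union_right _ (Finset.mem_union_right _ (mem_vars_bigAnd.2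
      ⟨_, List.mem_flatMap.2 ⟨i, List.mem_range.2 hi, List.mem_map.2
        ⟨0, List.mem_range.2 hpos, rfl⟩⟩, ?_⟩))
    rw [vars_not, vars_eqVar]
    simp

theorem vars_subset_cubeWit {k : ℕ} {c : List (Lit SigP)} {l : Lit SigP} (hl : l ∈ c) :
    vars l.2 ⊆ vars (cubeWit k c) := fun x hx => by
  rw [cubeWit, vars_inf]
  refine Finset.mem_union_left _ (mem_vars_bigAnd.2 ⟨_, List.mem_map.2 ⟨l, hl, rfl⟩, ?_⟩)
  rw [Lit.toFormula]
  split_ifs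
  · exact hx
  · rwa [vars_not]

theorem qf_cubeWit {k : ℕ} {c : List (Lit SigP)} (hc : ∀ l ∈ c, BoundedFormula.IsAtomic l.2) :
    QF (cubeWit k c) := by
  refine (qf_bigAnd fun ψ hψ => ?_).inf ((qf_eqVar _ _).inf (qf_bigAnd fun ψ hψ => ?_))
  · obtain ⟨l, hl, rfl⟩ := List.mem_map.1 hψ
    rw [Lit.toFormula]
    split_ifs
    · exact (hc l hl).isQF
    · exact (hc l hl).isQF.not
  · simp only [List.mem_flatMap, List.mem_map] at hψ
    obtain ⟨j, -, i, -, rfl⟩ := hψ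
    exact (qf_eqVar _ _).not

/-! ### The strong witness -/

theorem realize_witEq {M : Type} [SigP.Structure M] {v : ℕ → M} {φ : SigP.Formula ℕ} :
    (witEq φ).Realize v ↔ ∃ c ∈ dnf φ true, (cubeWit (freshIndex φ) c).Realize v := by
  simp [witEq]

theorem vars_cubeWit_subset {φ : SigP.Formula ℕ} {c : List (Lit SigP)} (hc : c ∈ dnf φ true) :
    vars (cubeWit (freshIndex φ) c) ⊆ vars (witEq φ) := fun _ hx =>
  mem_vars_bigOr.2 ⟨_, List.mem_map.2 ⟨c, hc, rfl⟩, hx⟩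

/-- If `φ` holds, so does one of its cubes; a literal `P n` in it gives the domain `n` elements,
which the fresh variables can enumerate. Conversely, each disjunct contains its cube, hence implies
`φ`, whose variables were left unchanged. -/
theorem witEq_equiv {φ : SigP.Formula ℕ} (hφ : QF φ) (A : Interp theoryEq) :
    A.Sat φ ↔ ∃ v : ℕ → A.Dom, (∀ x, x ∉ vars (witEq φ) \ vars φ → v x = A.val x) ∧
      (witEq φ).Realize v := by
  classical
  set k := freshIndex φ with hk
  constructor
  · intro hA
    obtain ⟨c, hc, hcube⟩ := (exists_dnf_realize_iff (v := A.val) hφ true).2 (iff_of_true hA rfl)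
    have hlit := dnf_literals hφ true c hc
    -- It is enough to alter the `n` fresh variables: they are not in `φ`, and each of them occurs
    -- in the witness.
    suffices h : ∃ v : ℕ → A.Dom,
        (∀ x, (∀ i < maxPosIndex c, x ≠ k + i) → v x = A.val x) ∧
          ∀ i j, i < j → j < maxPosIndex c → v (k + i) ≠ v (k + j) by
      obtain ⟨v, hv, hne⟩ := h
      have hfresh (x : ℕ) (hx : x ∈ vars φ) : v x = A.val x :=
        hv x fun i _ hi => notMem_vars_of_freshIndex_le (by omega) (hi ▸ hx)
      refine ⟨v, fun x hx => hv x fun i hi h => hx ?_,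
        realize_witEq.2 ⟨c, hc, realize_cubeWit.2 ⟨fun l hl => ?_, hne⟩⟩⟩
      · rw [h, Finset.mem_sdiff]
        exact ⟨vars_cubeWit_subset hc (add_mem_vars_cubeWit hi),
          notMem_vars_of_freshIndex_le (by omega)⟩
      · have := hcube l hl
        rw [realize_litToFormula] at this ⊢
        rwa [realize_congr_of_qf (hlit l hl).1.isQF fun x hx => hfresh x ((hlit l hl).2 hx)]
    rcases Nat.eq_zero_or_pos (maxPosIndex c) with h0 | hpos
    · exact ⟨A.val, fun _ _ => rfl, fun i j _ hj => absurd hj (by omega)⟩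
    · obtain ⟨e⟩ := nonempty_equiv_of_cube A.models (fun l hl => (hlit l hl).1) hcube hpos
      refine ⟨fun x => if h : k ≤ x ∧ x - k < maxPosIndex c then e ⟨x - k, h.2⟩ else A.val x,
        fun x hx => dif_neg fun h => hx _ h.2 (by omega), fun i j hij hj => ?_⟩
      have hi : i < maxPosIndex c := hij.trans hj
      simpa [hi, hj] using hij.ne
  · rintro ⟨v, hv, hw⟩
    obtain ⟨c, hc, h⟩ := realize_witEq.1 hw
    have := ((exists_dnf_realize_iff hφ true).1 ⟨c, hc, (realize_cubeWit.1 h).1⟩).2 rfl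
    exact (realize_congr_of_qf hφ fun x hx => hv x fun h => (Finset.mem_sdiff.1 h).2 hx).1 this

/-- The formula `θ` stands for anything that is preserved when the equalities between its variables
are; `⊤` yields condition (II) and an arrangement yields (II'). -/
theorem witEq_minimal {φ θ : SigP.Formula ℕ} (hφ : QF φ)
    (hθ : ∀ (M N : Type) [SigP.Structure M] [SigP.Structure N] (v : ℕ → M) (w : ℕ → N),
      (∀ x ∈ vars θ, ∀ y ∈ vars θ, (v x = v y ↔ w x = w y)) → θ.Realize v → θ.Realize w)
    (h : Satisfiable theoryEq (witEq φ ⊓ θ)) :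
    ∃ A : Interp theoryEq, A.Sat (witEq φ ⊓ θ) ∧ A.Minimal (witEq φ ⊓ θ) := by
  classical
  obtain ⟨A, hA⟩ := h
  have hA' := Formula.realize_inf.1 hA
  obtain ⟨c, hc, hcw⟩ := realize_witEq.1 hA'.1
  have hsub : vars (cubeWit (freshIndex φ) c) ⊆ vars (witEq φ ⊓ θ) := by
    rw [vars_inf]
    exact (vars_cubeWit_subset hc).trans Finset.subset_union_left
  obtain ⟨hcube, hne⟩ := realize_cubeWit.1 hcw
  have hlit := dnf_literals hφ true c hc
  rcases Nat.eq_zero_or_pos (maxPosIndex c) with h0 | hpos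
  -- No `P n` occurs positively in the cube, so restricting to the values of the variables and
  -- making all `P n` false preserves its literals and satisfies the axioms vacuously. Variables
  -- that do not occur are sent to the value of `w₀`.
  · let D : Type := A.val '' vars (witEq φ ⊓ θ)
    let _ : SigP.Structure D := structureP D fun _ => False
    have hk := hsub (self_mem_vars_cubeWit (freshIndex φ) c)
    let w : ℕ → D := fun x => if hx : x ∈ vars (witEq φ ⊓ θ) then ⟨A.val x, x, hx, rfl⟩
      else ⟨A.val (freshIndex φ), _, hk, rfl⟩
    have hw (x : ℕ) (hx : x ∈ vars (witEq φ ⊓ θ)) : (w x : A.Dom) = A.val x := by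
      simp only [w, dif_pos hx]
    have hval (x : ℕ) (hx : x ∈ vars (witEq φ ⊓ θ)) (y : ℕ) (hy : y ∈ vars (witEq φ ⊓ θ)) :
        A.val x = A.val y ↔ w x = w y := by
      rw [← hw x hx, ← hw y hy, Subtype.val_inj]
    refine ⟨⟨D, w, models_theoryEq_iff.2 fun n hn => (hn : False).elim⟩, ?_, ?_⟩
    · refine Formula.realize_inf.2 ⟨realize_witEq.2 ⟨c, hc, realize_cubeWit.2
        ⟨fun l hl => ?_, fun i j _ hj => absurd hj (by omega)⟩⟩, hθ _ _ A.val w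
          (fun x hx y hy => hval x ?_ y ?_) hA'.2⟩
      · have hsub' := (vars_subset_cubeWit hl).trans hsub
        have hl' := hcube l hl
        have hat := (hlit l hl).1
        by_cases hP : ∃ n, l.2 = atomP n
        · obtain ⟨n, hn⟩ := hP
          obtain ⟨b, ψ⟩ := l
          dsimp only at hn
          subst hn
          cases b with
          | true =>
            have := posIndex_le_maxPosIndex hl
            rw [posIndex_atomP] at this
            have := n.pos
            omega
          | false =>
            rw [realize_litToFormula, realize_atomP]
            exact iff_of_false id Bool.false_ne_true
        · rw [realize_litToFormula] at hl' ⊢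
          rwa [← realize_congr_of_isAtomic hat
            (fun x hx y hy => hval x (hsub' hx) y (hsub' hy)) fun n hn => absurd ⟨n, hn⟩ hP]
      · rw [vars_inf]; exact Finset.mem_union_right _ hx
      · rw [vars_inf]; exact Finset.mem_union_right _ hy
    · rintro ⟨_, x, hx, rfl⟩
      exact ⟨x, hx, Subtype.ext (hw x hx)⟩
  · obtain ⟨e⟩ := nonempty_equiv_of_cube A.models (fun l hl => (hlit l hl).1) hcube hpos
    refine ⟨A, hA, fun a => ?_⟩
    have hinj : Function.Injective
        fun i : Fin (maxPosIndex c) => A.val (freshIndex φ + i) := fun i j hij => by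
      by_contra hij'
      rcases lt_or_gt_of_ne hij' with h | h
      · exact hne i j h j.2 hij
      · exact hne j i h i.2 hij.symm
    -- The given interpretation is already minimal: `n` distinct values in a domain with `n`
    -- elements exhaust it. Transport along `e` gives an injective self-map of a finite set, which
    -- is surjective.
    obtain ⟨i, hi⟩ := ((Equiv.bijective e).surjective.comp
      (Finite.injective_iff_surjective.1 (e.symm.injective.comp hinj))) a
    refine ⟨freshIndex φ + i, hsub (add_mem_vars_cubeWit i.2), ?_⟩
    simpa using hi

theorem realize_arrangement {L : FirstOrder.Language.{0, 0}} {M : Type} [L.Structure M] {v : ℕ → M}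
    {V : Finset ℕ} {E : Setoid V} :
    (arrangement V E : L.Formula ℕ).Realize v ↔ ∀ x y : V, v x = v y ↔ E x y := by
  classical
  rw [arrangement, realize_bigAnd, List.forall_mem_map]
  simp only [Finset.mem_toList, Finset.mem_univ, forall_const, Prod.forall]
  refine forall₂_congr fun x y => ?_
  split_ifs with h <;> simp [h]

/-- The diagonal conjunct `x = x` makes every element of `V` occur, so preserving the equalities
between variables of the arrangement covers all of `V`. -/
theorem subset_vars_arrangement {L : FirstOrder.Language.{0, 0}} {V : Finset ℕ} {E : Setoid V} :
    V ⊆ vars (arrangement V E : L.Formula ℕ) := fun x hx => by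
  classical
  refine mem_vars_bigAnd.2 ⟨_, List.mem_map.2 ⟨(⟨x, hx⟩, ⟨x, hx⟩), by simp, rfl⟩, ?_⟩
  split_ifs <;> simp [vars_not, vars_eqVar]

theorem isStrongWitness_witEq : IsStrongWitness theoryEq witEq where
  qf φ hφ := qf_bigOr fun ψ hψ => by
    obtain ⟨c, hc, rfl⟩ := List.mem_map.1 hψ
    exact qf_cubeWit fun l hl => (dnf_literals hφ true c hc l hl).1
  equiv φ hφ A := witEq_equiv hφ A
  minimal φ hφ h := by
    have hsat (A : Interp theoryEq) : A.Sat (witEq φ ⊓ ⊤) ↔ A.Sat (witEq φ) := by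
      simp [Interp.Sat]
    obtain ⟨B, hB⟩ := h
    obtain ⟨A, hA, hmin⟩ := witEq_minimal (θ := ⊤) hφ
      (fun _ _ _ _ _ _ _ _ => Formula.realize_top.2 trivial) ⟨B, (hsat B).2 hB⟩
    refine ⟨A, (hsat A).1 hA, fun a => ?_⟩
    have hvars : vars (witEq φ ⊓ ⊤) = vars (witEq φ) := by
      rw [vars_inf]
      simp [vars]
    rw [← hvars]
    exact hmin a
  strong φ hφ V E h := by
    refine witEq_minimal hφ (fun M N _ _ v w hvw hv => ?_) h
    rw [realize_arrangement] at hv ⊢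
    intro x y
    rw [← hv x y]
    exact (hvw x (subset_vars_arrangement x.2) y (subset_vars_arrangement y.2)).symm

/-! ### Gödel numbers of Boolean combinations -/

section Codes

variable {L : FirstOrder.Language.{0, 0}} [SymbolCoding L]

/-- Gödel number of a negation. -/
def notCode (a : ℕ) : ℕ := impCode a 0

/-- Gödel number of a conjunction. -/
def andCode (a b : ℕ) : ℕ := notCode (impCode a (notCode b))

/-- Gödel number of a disjunction. -/
def orCode (a b : ℕ) : ℕ := impCode (notCode a) b

/-- Gödel number of the conjunction of a list of formulas. -/
def bigAndCode (l : List ℕ) : ℕ := l.foldr andCode (notCode 0)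

/-- Gödel number of an equation between two variables. -/
def eqCode (x y : ℕ) : ℕ := 4 * Nat.pair (3 * x) (3 * y) + 1

theorem formulaCode_not (φ : L.Formula ℕ) : formulaCode (∼φ) = notCode (formulaCode φ) :=
  (formulaCode_imp φ ⊥).trans (by rw [formulaCode_bot, notCode])

theorem formulaCode_inf (φ ψ : L.Formula ℕ) :
    formulaCode (φ ⊓ ψ) = andCode (formulaCode φ) (formulaCode ψ) := by
  change formulaCode (∼(φ.imp (∼ψ))) = _
  rw [formulaCode_not]
  exact congrArg notCode ((formulaCode_imp φ (∼ψ)).trans (by rw [formulaCode_not]))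

theorem formulaCode_sup (φ ψ : L.Formula ℕ) :
    formulaCode (φ ⊔ ψ) = orCode (formulaCode φ) (formulaCode ψ) := by
  change formulaCode ((∼φ).imp ψ) = _
  exact (formulaCode_imp (∼φ) ψ).trans (by rw [formulaCode_not, orCode])

theorem formulaCode_top : formulaCode (⊤ : L.Formula ℕ) = notCode 0 := by
  change formulaCode (∼⊥) = _
  rw [formulaCode_not, formulaCode_bot]

theorem formulaCode_bigAnd (l : List (L.Formula ℕ)) :
    formulaCode (bigAnd l) = bigAndCode (l.map formulaCode) := by
  induction l with
  | nil => exact formulaCode_top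
  | cons φ l ih =>
    rw [bigAnd, List.foldr_cons, ← bigAnd, formulaCode_inf, ih]
    rfl

theorem formulaCode_bigOr (l : List (L.Formula ℕ)) :
    formulaCode (bigOr l) = (l.map formulaCode).foldr orCode 0 := by
  induction l with
  | nil => exact formulaCode_bot
  | cons φ l ih =>
    rw [bigOr, List.foldr_cons, ← bigOr, formulaCode_sup, ih]
    rfl

theorem formulaCode_eqVar' (x y : ℕ) : formulaCode (eqVar x y : L.Formula ℕ) = eqCode x y :=
  formulaCode_eqVar x y

end Codes

section Primrec

variable {α : Type} [Primcodable α] {f g : α → ℕ}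

theorem Primrec.impCode (hf : Primrec f) (hg : Primrec g) : Primrec fun a => impCode (f a) (g a) :=
  Primrec.nat_add.comp (Primrec.nat_mul.comp (.const 4) (Primrec₂.natPair.comp hf hg)) (.const 3)

theorem Primrec.notCode (hf : Primrec f) : Primrec fun a => notCode (f a) :=
  Primrec.impCode hf (.const 0)

theorem Primrec.andCode (hf : Primrec f) (hg : Primrec g) : Primrec fun a => andCode (f a) (g a) :=
  Primrec.notCode (Primrec.impCode hf (Primrec.notCode hg))

theorem Primrec.orCode (hf : Primrec f) (hg : Primrec g) : Primrec fun a => orCode (f a) (g a) :=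
  Primrec.impCode (Primrec.notCode hf) hg

theorem Primrec.eqCode (hf : Primrec f) (hg : Primrec g) : Primrec fun a => eqCode (f a) (g a) :=
  Primrec.nat_add.comp (Primrec.nat_mul.comp (.const 4) (Primrec₂.natPair.comp
    (Primrec.nat_mul.comp (.const 3) hf) (Primrec.nat_mul.comp (.const 3) hg))) (.const 1)

theorem Primrec.bigAndCode {f : α → List ℕ} (hf : Primrec f) :
    Primrec fun a => bigAndCode (f a) :=
  Primrec.list_foldr (h := fun _ (p : ℕ × ℕ) => TheoryCombination.andCode p.1 p.2) hf (.const _)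
    (Primrec.andCode (Primrec.fst.comp .snd) (Primrec.snd.comp .snd))

end Primrec

/-! ### Computability of the strong witness -/

/-- The disjunctive normal forms of a formula and of its negation, on Gödel numbers. -/
def dnfCode : ℕ → List (List ℕ) × List (List ℕ) :=
  codeFold (fun c => if c = 0 then ([], [ [] ]) else ([ [c] ], [ [notCode c] ]))
    fun x y => (x.2 ++ y.1, x.1.flatMap fun c => y.2.map fun d => c ++ d)

theorem dnfCode_formulaCode {L : FirstOrder.Language.{0, 0}} [SymbolCoding L] {φ : L.Formula ℕ}
    (hφ : QF φ) : dnfCode (formulaCode φ) =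
      ((dnf φ true).map (List.map (formulaCode ∘ Lit.toFormula)),
        (dnf φ false).map (List.map (formulaCode ∘ Lit.toFormula))) := by
  induction hφ with
  | falsum =>
    rw [formulaCode_falsum, dnfCode, codeFold_leaf _ _ (by omega)]
    simp [dnf]
  | of_isAtomic h =>
    have := formulaCode_atom_mod h
    rw [dnfCode, codeFold_leaf _ _ (formulaCode_atom_mod_ne h), if_neg (by omega),
      dnf_atomic h, dnf_atomic h]
    simp [Lit.toFormula, formulaCode_not]
  | imp _ _ h₁ h₂ =>
    rw [formulaCode_imp, impCode, dnfCode, codeFold_imp, ← dnfCode, h₁, h₂]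
    simp [dnf, List.flatMap_map, List.map_flatMap, Function.comp_def]

theorem primrec_dnfCode : Primrec dnfCode := by
  refine (primrec_codeFold (α := Unit)
    (leaf := fun _ c => if c = 0 then (([], [ [] ]) : List (List ℕ) × List (List ℕ))
      else ([ [c] ], [ [notCode c] ]))
    (node := fun _ p => (p.1.2 ++ p.2.1, p.1.1.flatMap fun c => p.2.2.map fun d => c ++ d))
    ?_ ?_).comp (Primrec.const ()) Primrec.id
  · have hs {β : Type} [Primcodable β] {f : Unit × ℕ → β} (hf : Primrec f) :
        Primrec fun a => [f a] := Primrec.list_cons.comp hf (.const [])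
    exact Primrec.ite (Primrec.eq.comp .snd (.const 0)) (.const _)
      (Primrec.pair (hs (hs .snd)) (hs (hs (Primrec.notCode .snd))))
  · refine Primrec.pair (Primrec.list_append.comp (Primrec.snd.comp (Primrec.fst.comp .snd))
      (Primrec.fst.comp (Primrec.snd.comp .snd))) ?_
    refine Primrec.list_flatMap (Primrec.fst.comp (Primrec.fst.comp .snd)) ?_
    refine Primrec.list_map (Primrec.snd.comp (Primrec.snd.comp (Primrec.snd.comp .fst))) ?_
    exact Primrec.list_append.comp (Primrec.snd.comp .fst) .snd

/-- `freshIndex` on Gödel numbers. -/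
def freshCode : ℕ → ℕ :=
  codeFold (fun c => if c % 4 = 1 then
    max ((c / 4).unpair.1 / 3 + 1) ((c / 4).unpair.2 / 3 + 1) else 0) max

theorem freshCode_formulaCode {φ : SigP.Formula ℕ} (hφ : QF φ) :
    freshCode (formulaCode φ) = freshIndex φ := by
  induction hφ with
  | falsum =>
    rw [formulaCode_falsum, freshCode, codeFold_leaf _ _ (by omega)]
    rfl
  | of_isAtomic h =>
    rw [freshCode, codeFold_leaf _ _ (formulaCode_atom_mod_ne h)]
    rcases sigP_isAtomic_iff.1 h with ⟨i, j, rfl⟩ | ⟨n, rfl⟩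
    · rw [formulaCode_eqVar, if_pos (by omega), show
        (4 * Nat.pair (3 * i) (3 * j) + 1) / 4 = Nat.pair (3 * i) (3 * j) by omega,
        freshIndex, vars_eqVar]
      simp
    · rw [formulaCode_atomP, if_neg (by omega)]
      rfl
  | imp _ _ h₁ h₂ =>
    rw [formulaCode_imp, impCode, freshCode, codeFold_imp, ← freshCode, h₁, h₂]
    exact Finset.sup_union.symm

theorem primrec_freshCode : Primrec freshCode := by
  have hu : Primrec fun a : Unit × ℕ => (a.2 / 4).unpair :=
    Primrec.unpair.comp (Primrec.nat_div.comp .snd (.const 4))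
  refine (primrec_codeFold (α := Unit)
    (leaf := fun _ c => if c % 4 = 1 then
      max ((c / 4).unpair.1 / 3 + 1) ((c / 4).unpair.2 / 3 + 1) else 0)
    (node := fun _ p => max p.1 p.2) ?_
    (Primrec.nat_max.comp (Primrec.fst.comp .snd) (Primrec.snd.comp .snd))).comp
      (Primrec.const ()) Primrec.id
  exact Primrec.ite (Primrec.eq.comp (Primrec.nat_mod.comp .snd (.const 4)) (.const 1))
    (Primrec.nat_max.comp
      (Primrec.succ.comp (Primrec.nat_div.comp (Primrec.fst.comp hu) (.const 3)))
      (Primrec.succ.comp (Primrec.nat_div.comp (Primrec.snd.comp hu) (.const 3)))) (.const 0)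

/-- `Lit.posIndex` on Gödel numbers. -/
def posIndexCode (c : ℕ) : ℕ := if c % 4 = 2 then (c / 4).unpair.1.unpair.2 else 0

/-- A negative literal is an implication, with code congruent to 3 modulo 4, so its residue already
separates it from the positive literals `P n`. -/
theorem posIndexCode_formulaCode {l : Lit SigP} (hl : BoundedFormula.IsAtomic l.2) :
    posIndexCode (formulaCode (Lit.toFormula l)) = Lit.posIndex l := by
  obtain ⟨b, φ⟩ := l
  cases b with
  | false =>
    rw [Lit.toFormula, if_neg Bool.false_ne_true, formulaCode_not, notCode, impCode, posIndexCode,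
      if_neg (by omega)]
    rfl
  | true =>
    rw [Lit.toFormula, if_pos rfl]
    dsimp only at hl ⊢
    rcases sigP_isAtomic_iff.1 hl with ⟨i, j, rfl⟩ | ⟨n, rfl⟩
    · rw [formulaCode_eqVar, posIndexCode, if_neg (by omega)]
      rfl
    · rw [formulaCode_atomP, posIndexCode, if_pos (by omega), show
        (4 * Nat.pair (Nat.pair 0 n) 0 + 2) / 4 = Nat.pair (Nat.pair 0 n) 0 by omega,
        posIndex_atomP]
      simp

/-- `cubeWit` on Gödel numbers. -/
def cubeWitCode (k : ℕ) (c : List ℕ) : ℕ :=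
  andCode (bigAndCode c) (andCode (eqCode k k)
    (bigAndCode ((List.range ((c.map posIndexCode).foldr max 0)).flatMap fun j =>
      (List.range j).map fun i => notCode (eqCode (k + i) (k + j)))))

theorem cubeWitCode_formulaCode {k : ℕ} {c : List (Lit SigP)}
    (hc : ∀ l ∈ c, BoundedFormula.IsAtomic l.2) :
    cubeWitCode k (c.map (formulaCode ∘ Lit.toFormula)) = formulaCode (cubeWit k c) := by
  have hmax : ((c.map (formulaCode ∘ Lit.toFormula)).map posIndexCode).foldr max 0 =
      maxPosIndex c := by
    rw [maxPosIndex, List.map_map]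
    congr 1
    exact List.map_congr_left fun l hl => posIndexCode_formulaCode (hc l hl)
  rw [cubeWitCode, hmax, cubeWit, formulaCode_inf, formulaCode_inf, formulaCode_bigAnd,
    formulaCode_bigAnd, formulaCode_eqVar']
  simp [List.map_flatMap, formulaCode_not, formulaCode_eqVar', Function.comp_def]

theorem primrec_cubeWitCode : Primrec₂ cubeWitCode := by
  have hpos : Primrec posIndexCode :=
    Primrec.ite (Primrec.eq.comp (Primrec.nat_mod.comp .id (.const 4)) (.const 2))
      (Primrec.snd.comp (Primrec.unpair.comp (Primrec.fst.comp (Primrec.unpair.comp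
        (Primrec.nat_div.comp .id (.const 4)))))) (.const 0)
  have hmax : Primrec fun a : ℕ × List ℕ => (a.2.map posIndexCode).foldr max 0 :=
    Primrec.list_foldr (h := fun _ (p : ℕ × ℕ) => max p.1 p.2)
      (Primrec.list_map (g := fun _ => posIndexCode) .snd (hpos.comp .snd)) (.const 0)
      (Primrec.nat_max.comp (Primrec.fst.comp .snd) (Primrec.snd.comp .snd))
  refine Primrec.andCode (Primrec.bigAndCode .snd) (Primrec.andCode (Primrec.eqCode .fst .fst)
    (Primrec.bigAndCode ?_))
  refine Primrec.list_flatMap (Primrec.list_range.comp hmax) ?_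
  refine Primrec.list_map (Primrec.list_range.comp .snd) ?_
  have hk : Primrec fun a : ((ℕ × List ℕ) × ℕ) × ℕ => a.1.1.1 :=
    Primrec.fst.comp (Primrec.fst.comp .fst)
  exact Primrec.notCode (Primrec.eqCode (Primrec.nat_add.comp hk .snd)
    (Primrec.nat_add.comp hk (Primrec.snd.comp .fst)))

theorem computableOnQF_witEq : ComputableOnQF witEq := by
  refine ⟨fun c => ((dnfCode c).1.map (cubeWitCode (freshCode c))).foldr orCode 0, ?_, ?_⟩
  · refine Primrec.to_comp (Primrec.list_foldr (h := fun _ (p : ℕ × ℕ) => orCode p.1 p.2)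
      (Primrec.list_map (Primrec.fst.comp primrec_dnfCode) ?_) (.const 0)
      (Primrec.orCode (Primrec.fst.comp .snd) (Primrec.snd.comp .snd)))
    exact primrec_cubeWitCode.comp (primrec_freshCode.comp .fst) .snd
  · intro φ hφ
    dsimp only
    rw [dnfCode_formulaCode hφ, freshCode_formulaCode hφ, witEq, formulaCode_bigOr, List.map_map,
      List.map_map]
    congr 1
    exact List.map_congr_left fun c hc =>
      cubeWitCode_formulaCode fun l hl => (dnf_literals hφ true c hc l hl).1

/-! ### Injectivity of the Gödel numbering -/

section Injective

variable {L : FirstOrder.Language.{0, 0}} [SymbolCoding L]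

theorem termCode_injective {n : ℕ} :
    ∀ t u : L.Term (ℕ ⊕ Fin n), termCode t = termCode u → t = u
  | .var (Sum.inl i), .var (Sum.inl j), h => by
    simp only [termCode] at h
    rw [show i = j by omega]
  | .var (Sum.inr i), .var (Sum.inr j), h => by
    simp only [termCode] at h
    rw [show i = j from Fin.ext (by omega)]
  | .var (Sum.inl i), .var (Sum.inr j), h => by simp only [termCode] at h; omega
  | .var (Sum.inr i), .var (Sum.inl j), h => by simp only [termCode] at h; omega
  | .var (Sum.inl i), .func g ts, h => by simp only [termCode] at h; omega
  | .var (Sum.inr i), .func g ts, h => by simp only [termCode] at h; omega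
  | .func g ts, .var (Sum.inl i), h => by simp only [termCode] at h; omega
  | .func g ts, .var (Sum.inr i), h => by simp only [termCode] at h; omega
  | .func (l := k) g ts, .func (l := k') g' ts', h => by
    simp only [termCode] at h
    have h' := Nat.pair_eq_pair.1 (Nat.eq_of_mul_eq_mul_left (by omega) (Nat.add_right_cancel h))
    obtain ⟨h₁, h₂⟩ := Nat.pair_eq_pair.1 h'.1
    subst h₁
    have hg := SymbolCoding.funCode_injective k h₂
    have hts := List.ofFn_injective (Encodable.encode_injective h'.2)
    rw [hg, show ts = ts' from funext fun i => termCode_injective _ _ (congrFun hts i)]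

/-- Decidability of a theory is a statement about codes. The reduction therefore needs that the
query is the only formula with its code. -/
theorem formulaCode_injective {n : ℕ} :
    ∀ φ ψ : L.BoundedFormula ℕ n, formulaCode φ = formulaCode ψ → φ = ψ := by
  intro φ
  induction φ with
  | falsum => intro ψ h; cases ψ <;> simp only [formulaCode] at h <;> first | rfl | omega
  | equal t u =>
    intro ψ h
    cases ψ <;> simp only [formulaCode] at h
    case equal t' u' =>
      have h' := Nat.pair_eq_pair.1 (Nat.eq_of_mul_eq_mul_left (by omega) (Nat.add_right_cancel h))
      rw [termCode_injective _ _ h'.1, termCode_injective _ _ h'.2]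
    all_goals omega
  | rel R ts =>
    intro ψ h
    cases ψ <;> simp only [formulaCode] at h
    case rel k' R' ts' =>
      have h' := Nat.pair_eq_pair.1 (Nat.eq_of_mul_eq_mul_left (by omega) (Nat.add_right_cancel h))
      obtain ⟨h₁, h₂⟩ := Nat.pair_eq_pair.1 h'.1
      subst h₁
      have hR := SymbolCoding.relCode_injective _ h₂
      have hts := List.ofFn_injective (Encodable.encode_injective h'.2)
      rw [hR, show ts = ts' from funext fun i => termCode_injective _ _ (congrFun hts i)]
    all_goals omega
  | imp φ ψ ih₁ ih₂ =>
    intro χ h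
    cases χ <;> simp only [formulaCode] at h
    case imp φ' ψ' =>
      have h' := Nat.pair_eq_pair.1 (Nat.eq_of_mul_eq_mul_left (by omega) (Nat.add_right_cancel h))
      rw [ih₁ _ h'.1, ih₂ _ h'.2]
    all_goals omega
  | all φ ih =>
    intro ψ h
    cases ψ <;> simp only [formulaCode] at h
    case all φ' => rw [ih φ' (by omega)]
    all_goals omega

end Injective

/-! ### Counting -/

theorem count_zero (f : ℕ → Bool) (b : Bool) : count f b 0 = 0 := by simp [count]

theorem count_succ (f : ℕ → Bool) (b : Bool) (k : ℕ) :
    count f b (k + 1) = count f b k + if f (k + 1) = b then 1 else 0 := by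
  simp only [count, Finset.card_filter]
  rw [Finset.sum_Icc_succ_top (by omega)]

theorem count_mono (f : ℕ → Bool) (b : Bool) : Monotone (count f b) :=
  monotone_nat_of_le_succ fun k => by rw [count_succ]; omega

theorem count_add_count (f : ℕ → Bool) (k : ℕ) : count f true k + count f false k = k := by
  induction k with
  | zero => simp [count_zero]
  | succ k ih =>
    rw [count_succ, count_succ]
    cases f (k + 1) <;> simp <;> omega

/-! ### Undecidability of the combination -/

section Combination

variable (f : ℕ → Bool)

theorem card_fixSet_add (M : Type) [SigS.Structure M] [Finite M] :
    Nat.card (fixSet M true) + Nat.card (fixSet M false) = Nat.card M := by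
  have : fixSet M false = (fixSet M true)ᶜ := by
    ext x
    simp [fixSet]
  rw [this, Nat.card_coe_set_eq, Nat.card_coe_set_eq, Set.ncard_add_ncard_compl]

/-- The counts of fixed and non-fixed points at `k` add up to `k`. In a domain of size `N` the exact
disjunct can thus hold only at `i + 1 = N`, and the lower bounds only for `k ≤ N`. -/
theorem models_theoryF_iff_card {M : Type} [SigS.Structure M] [Nonempty M] [Finite M] :
    M ⊨ theoryF f ↔ Nat.card (fixSet M true) = count f true (Nat.card M) := by
  have hadd := card_fixSet_add M
  have hcount := count_add_count f
  have hembed (n : ℕ) (b : Bool) : Nonempty (Fin n ↪ fixSet M b) ↔ n ≤ Nat.card (fixSet M b) := by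
    constructor
    · rintro ⟨e⟩
      simpa using Nat.card_le_card_of_injective e e.injective
    · intro h
      exact ⟨(Fin.castLEEmb h).trans (Finite.equivFin _).symm.toEmbedding⟩
  have hequiv (n : ℕ) (b : Bool) : Nonempty (Fin n ≃ fixSet M b) ↔ n = Nat.card (fixSet M b) := by
    constructor
    · rintro ⟨e⟩
      simpa using Nat.card_congr e
    · rintro rfl
      exact ⟨(Finite.equivFin _).symm⟩
  simp only [models_theoryF_iff, hembed, hequiv, Bool.forall_bool]
  constructor
  · intro h
    -- At this index the lower bounds would require more elements than `M` has, so an exact disjunct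
    -- must hold.
    rcases h (Nat.card M + 1) (by omega) with ⟨h1, h2⟩ | ⟨i, -, h1, h2⟩
    · have := hcount (Nat.card M + 1)
      omega
    · have := hcount (i + 1)
      rw [← h2, show i + 1 = Nat.card M by omega]
  · intro h k hk
    have hpos : 0 < Nat.card M := Nat.card_pos
    have := hcount (Nat.card M)
    rcases lt_or_ge k (Nat.card M) with hlt | hle
    · have h1 := count_mono f true hlt.le
      have h2 := count_mono f false hlt.le
      left; omega
    · refine Or.inr ⟨Nat.card M - 1, by omega, ?_⟩
      rw [Nat.sub_add_cancel hpos]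
      omega

/-- The formula that says that `P n` holds and that the variables `0, …, m - 1` denote distinct
fixed points of `s`. -/
def queryFormula (n : ℕ+) (m : ℕ) : (SigS.sum SigP).Formula ℕ :=
  (LHom.sumInr : SigP →ᴸ SigS.sum SigP).onFormula (atomP n) ⊓
    bigAnd ((List.range m).flatMap fun j =>
      (LHom.sumInl : SigS →ᴸ SigS.sum SigP).onFormula (fixLit true j) ::
        (List.range j).map fun i => ∼(eqVar i j))

theorem qf_queryFormula (n : ℕ+) (m : ℕ) : QF (queryFormula n m) := by
  refine (BoundedFormula.IsAtomic.isQF (.rel _ _)).inf (qf_bigAnd fun φ hφ => ?_)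
  simp only [List.mem_flatMap, List.mem_cons, List.mem_map] at hφ
  obtain ⟨j, -, rfl | ⟨i, -, rfl⟩⟩ := hφ
  · exact BoundedFormula.IsAtomic.isQF (.equal _ _)
  · exact (qf_eqVar i j).not

theorem realize_queryFormula {M : Type} [SigS.Structure M] [SigP.Structure M]
    [(SigS.sum SigP).Structure M] [(LHom.sumInl : SigS →ᴸ SigS.sum SigP).IsExpansionOn M]
    [(LHom.sumInr : SigP →ᴸ SigS.sum SigP).IsExpansionOn M] {v : ℕ → M} {n : ℕ+} {m : ℕ} :
    (queryFormula n m).Realize v ↔ HoldsP M n ∧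
      (∀ j < m, v j ∈ fixSet M true) ∧ ∀ i j, i < j → j < m → v i ≠ v j := by
  rw [queryFormula, Formula.realize_inf, LHom.realize_onFormula, realize_atomP, realize_bigAnd]
  refine and_congr_right' ⟨fun h => ⟨fun j hj => ?_, fun i j hij hj => ?_⟩, ?_⟩
  · have := h _ (List.mem_flatMap.2 ⟨j, List.mem_range.2 hj, List.mem_cons_self⟩)
    rwa [LHom.realize_onFormula, realize_fixLit] at this
  · have := h _ (List.mem_flatMap.2 ⟨j, List.mem_range.2 hj, List.mem_cons_of_mem _
      (List.mem_map.2 ⟨i, List.mem_range.2 hij, rfl⟩)⟩)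
    rwa [Formula.realize_not, realize_eqVar] at this
  · rintro ⟨h₁, h₂⟩ φ hφ
    simp only [List.mem_flatMap, List.mem_cons, List.mem_map, List.mem_range] at hφ
    obtain ⟨j, hj, rfl | ⟨i, hij, rfl⟩⟩ := hφ
    · rw [LHom.realize_onFormula, realize_fixLit]
      exact h₁ j hj
    · rw [Formula.realize_not, realize_eqVar]
      exact h₂ i j hij hj

theorem models_combination_iff {L₁ L₂ : FirstOrder.Language.{0, 0}} {T₁ : L₁.Theory}
    {T₂ : L₂.Theory} {M : Type} [L₁.Structure M] [L₂.Structure M] [(L₁.sum L₂).Structure M]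
    [(LHom.sumInl : L₁ →ᴸ L₁.sum L₂).IsExpansionOn M]
    [(LHom.sumInr : L₂ →ᴸ L₁.sum L₂).IsExpansionOn M] :
    M ⊨ combination T₁ T₂ ↔ M ⊨ T₁ ∧ M ⊨ T₂ := by
  rw [combination, Theory.model_union_iff, LHom.onTheory_model, LHom.onTheory_model]

/-- `P n` fixes the size at `n`, and then the axioms of `theoryF f` fix the number of fixed points
at `count f true n`. -/
theorem satisfiable_queryFormula_iff (hf : f 1 = true) (n : ℕ+) (m : ℕ) :
    Satisfiable (combination (theoryF f) theoryEq) (queryFormula n m) ↔ m ≤ count f true n := by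
  constructor
  · rintro ⟨A, hA⟩
    let _ : (SigS.sum SigP).Structure A.Dom := A.str
    let _ : SigS.Structure A.Dom := (LHom.sumInl : SigS →ᴸ SigS.sum SigP).reduct A.Dom
    let _ : SigP.Structure A.Dom := (LHom.sumInr : SigP →ᴸ SigS.sum SigP).reduct A.Dom
    obtain ⟨hF, hE⟩ := models_combination_iff.1 A.models
    obtain ⟨hP, hfix, hne⟩ := realize_queryFormula.1 hA
    obtain ⟨e⟩ := models_theoryEq_iff.1 hE n hP
    have : Finite A.Dom := Finite.of_equiv _ e
    have : Nonempty A.Dom := ⟨A.val 0⟩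
    have hcard : Nat.card A.Dom = n := by simpa using (Nat.card_congr e).symm
    rw [← hcard, ← (models_theoryF_iff_card f).1 hF]
    have hinj : Function.Injective
        fun i : Fin m => (⟨A.val i, hfix i i.2⟩ : fixSet A.Dom true) := fun i j hij => by
      have hij' : A.val i = A.val j := congrArg Subtype.val hij
      by_contra h
      rcases lt_or_gt_of_ne h with h | h
      · exact hne i j h j.2 hij'
      · exact hne j i h i.2 hij'.symm
    simpa using Nat.card_le_card_of_injective _ hinj
  · intro hm
    have hpos : 0 < count f true n := by
      have h1 : count f true 1 = 1 := by rw [count_succ, count_zero, if_pos hf]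
      have := count_mono f true (show 1 ≤ (n : ℕ) from n.pos)
      omega
    have hle : count f true n ≤ n := by have := count_add_count f n; omega
    let z : Fin n := ⟨0, n.pos⟩
    -- The first `count f true n` elements are fixed and the others go to `0`. Since `f 1 = true`,
    -- the element `0` is itself fixed, so exactly the others are non-fixed.
    let _ : SigS.Structure (Fin n) := structureS fun x => if (x : ℕ) < count f true n then x else z
    let _ : SigP.Structure (Fin n) := structureP (Fin n) fun k => k = n
    have hfix (x : Fin n) : x ∈ fixSet (Fin n) true ↔ (x : ℕ) < count f true n := by
      change ((if (x : ℕ) < count f true n then x else z) = x ↔ true = true) ↔ _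
      split_ifs with h
      · simpa using h
      · simp only [iff_true, h, iff_false]
        rintro rfl
        exact h hpos
    have hcard : Nat.card (fixSet (Fin n) true) = count f true n := by
      let e : fixSet (Fin n) true ≃ Fin (count f true n) :=
        ⟨fun x => ⟨x, (hfix x).1 x.2⟩, fun i => ⟨⟨i, i.2.trans_le hle⟩, (hfix _).2 i.2⟩,
          fun _ => rfl, fun _ => rfl⟩
      simpa using Nat.card_congr e
    have : Nonempty (Fin n) := ⟨z⟩
    let v : ℕ → Fin n := fun i => if h : i < n then ⟨i, h⟩ else z
    have hv (i : ℕ) (h : i < n) : (v i : ℕ) = i := by simp only [v, dif_pos h]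
    refine ⟨⟨Fin n, v, models_combination_iff.2
      ⟨(models_theoryF_iff_card f).2 ?_, models_theoryEq_iff.2 fun k hk => ?_⟩⟩,
      realize_queryFormula.2 ⟨?_, fun j hj => ?_, fun i j hij hj => ?_⟩⟩
    · simpa using hcard
    · have hk' : (k : ℕ) = n := hk
      rw [hk']
      exact ⟨Equiv.refl _⟩
    · exact rfl
    · refine (hfix _).2 ((hv j (by omega)).trans_lt (hj.trans_le hm))
    · intro h
      have h' : (v i : ℕ) = v j := congrArg Fin.val h
      rw [hv i (by omega), hv j (by omega)] at h'
      omega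

/-- Gödel number of `queryFormula n m`. -/
def queryCode (n m : ℕ) : ℕ :=
  andCode (4 * Nat.pair (Nat.pair 0 (2 * n + 1)) 0 + 2)
    (bigAndCode ((List.range m).flatMap fun j =>
      (4 * Nat.pair (appCode (3 * j)) (3 * j) + 1) ::
        (List.range j).map fun i => notCode (eqCode i j)))

/-- In the sum signature the symbol numbers are doubled on the left and doubled plus one on the
right: `s` keeps the number `0`, so `appCode` still applies, and `P n` gets `2 * n + 1`. -/
theorem formulaCode_queryFormula (n : ℕ+) (m : ℕ) :
    formulaCode (queryFormula n m) = queryCode n m := by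
  have hP : formulaCode ((LHom.sumInr : SigP →ᴸ SigS.sum SigP).onFormula (atomP n)) =
      4 * Nat.pair (Nat.pair 0 (2 * n + 1)) 0 + 2 := by
    simp only [atomP, Relations.formula, Relations.boundedFormula, LHom.onFormula,
      LHom.onBoundedFormula, formulaCode, List.ofFn_zero]
    rfl
  have hs (j : ℕ) : formulaCode ((LHom.sumInl : SigS →ᴸ SigS.sum SigP).onFormula (fixLit true j)) =
      4 * Nat.pair (appCode (3 * j)) (3 * j) + 1 := by
    simp only [fixLit, if_pos, LHom.onFormula, Term.equal, Term.bdEqual, Functions.apply₁,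
      LHom.onBoundedFormula, LHom.onTerm, Term.relabel, formulaCode, termCode, List.ofFn_succ,
      List.ofFn_zero, Encodable.encode_list_cons, Encodable.encode_list_nil, Encodable.encode_nat]
    rfl
  rw [queryFormula, formulaCode_inf, hP, formulaCode_bigAnd, queryCode]
  simp [List.map_flatMap, formulaCode_not, formulaCode_eqVar', hs, Function.comp_def]

theorem primrec_queryCode : Primrec₂ queryCode := by
  refine Primrec.andCode (Primrec.nat_add.comp (Primrec.nat_mul.comp (.const 4)
    (Primrec₂.natPair.comp (Primrec₂.natPair.comp (.const 0)
      (Primrec.nat_double_succ.comp .fst)) (.const 0))) (.const 2)) (Primrec.bigAndCode ?_)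
  refine Primrec.list_flatMap (Primrec.list_range.comp .snd) ?_
  have h3 : Primrec fun a : (ℕ × ℕ) × ℕ => 3 * a.2 := Primrec.nat_mul.comp (.const 3) .snd
  refine Primrec.list_cons.comp (Primrec.succ.comp (Primrec.nat_mul.comp (.const 4)
    (Primrec₂.natPair.comp (primrec_appCode.comp h3) h3))) ?_
  exact Primrec.list_map (Primrec.list_range.comp .snd)
    (Primrec.notCode (Primrec.eqCode .snd (Primrec.snd.comp .fst)))

/-- A decision procedure answers whether `m ≤ count f true (n + 1)`. Asking this with `m = count f
true n + 1` tells whether the count increases at `n + 1`, that is, the value `f (n + 1)`; so the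
count is computable by recursion, and then so is `f`. -/
theorem computable_of_decidableTheory_combination (hf : f 1 = true)
    (h : DecidableTheory (combination (theoryF f) theoryEq)) : Computable f := by
  obtain ⟨_, hd⟩ := h
  have hiff (n m : ℕ) : (∃ φ : (SigS.sum SigP).Formula ℕ,
      QF φ ∧ formulaCode φ = queryCode (n + 1) m ∧
      Satisfiable (combination (theoryF f) theoryEq) φ) ↔ m ≤ count f true (n + 1) := by
    have hn : ((n.succPNat : ℕ+) : ℕ) = n + 1 := rfl
    rw [← hn, ← satisfiable_queryFormula_iff f hf, ← formulaCode_queryFormula]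
    constructor
    · rintro ⟨φ, -, hφ, hs⟩
      rwa [← formulaCode_injective _ _ hφ]
    · exact fun hs => ⟨_, qf_queryFormula _ _, rfl, hs⟩
  have hq : Computable₂ fun n m : ℕ => decide (m ≤ count f true (n + 1)) :=
    (hd.comp (primrec_queryCode.to_comp.comp (Computable.succ.comp .fst) .snd)).of_eq
      fun p => by simp only [hiff]
  have hstep (n : ℕ) : decide (count f true n + 1 ≤ count f true (n + 1)) = f (n + 1) := by
    rw [count_succ]
    cases f (n + 1) <;> simp
  have hcount : Computable (count f true) := by
    refine (Computable.nat_rec (f := id) (g := fun _ => 0)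
      (h := fun (_ : ℕ) (p : ℕ × ℕ) =>
        p.2 + cond (decide (p.2 + 1 ≤ count f true (p.1 + 1))) 1 0) Computable.id
      (Computable.const 0) ?_).of_eq fun n => ?_
    · have hp : Computable fun a : ℕ × ℕ × ℕ => a.2.2 := Computable.snd.comp .snd
      exact (Primrec.nat_add.to_comp).comp hp (Computable.cond
        (hq.comp (Computable.fst.comp .snd) (Computable.succ.comp hp)) (.const 1) (.const 0))
    · induction n with
      | zero => rfl
      | succ n ih =>
        dsimp only [id] at ih ⊢
        rw [ih, hstep, count_succ]
        cases f (n + 1) <;> rfl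
  -- The value `f 0` is not seen by the counts, and is supplied as a constant.
  refine (Computable.nat_casesOn (f := id) (g := fun _ => f 0)
    (h := fun (_ n : ℕ) => decide (count f true n + 1 ≤ count f true (n + 1))) Computable.id
    (Computable.const _) (hq.comp .snd
      (Computable.succ.comp (hcount.comp .snd)))).of_eq fun n => ?_
  cases n with
  | zero => rfl
  | succ n => exact hstep n

end Combination

/-! ### Existence of admissible functions -/

/-- With `f (2 * m + 1) = g m` and `f (2 * m + 2) = !g m`, every initial segment of even length is
balanced, in particular those of length `2 ^ k` with `k ≥ 1`. Here `g 0 = true` gives `f 1 = true`,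
and `g (k + 1)` tells whether program `k` halts on input `0`, so a computable `f` would solve the
halting problem. -/
theorem exists_isAdmissible : ∃ f : ℕ → Bool, IsAdmissible f := by
  classical
  let g : ℕ → Bool := fun n => n.casesOn true fun k =>
    decide (Nat.Partrec.Code.eval (Denumerable.ofNat Nat.Partrec.Code k) 0).Dom
  let f : ℕ → Bool := fun n => if n % 2 = 1 then g (n / 2) else !g (n / 2 - 1)
  have hodd (m : ℕ) : f (2 * m + 1) = g m := by
    simp only [f]
    rw [if_pos (by omega), show (2 * m + 1) / 2 = m by omega]
  have heven (m : ℕ) : f (2 * m + 1 + 1) = !g m := by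
    simp only [f]
    rw [if_neg (by omega), show (2 * m + 1 + 1) / 2 - 1 = m by omega]
  have hcount (m : ℕ) : count f true (2 * m) = count f false (2 * m) := by
    induction m with
    | zero => rw [Nat.mul_zero, count_zero, count_zero]
    | succ m ih =>
      rw [show 2 * (m + 1) = 2 * m + 1 + 1 by ring]
      rw [count_succ f true, count_succ f true, count_succ f false, count_succ f false, hodd,
        heven, ih]
      cases g m <;> simp
  refine ⟨f, hodd 0, fun k hk => ?_, fun hf => ?_⟩
  · obtain ⟨j, rfl⟩ := Nat.exists_eq_add_of_le' hk
    rw [pow_succ, mul_comm]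
    exact hcount _
  · refine ComputablePred.halting_problem 0 ⟨Classical.decPred _, ?_⟩
    have h : Computable fun c : Nat.Partrec.Code => f (2 * (Encodable.encode c + 1) + 1) :=
      hf.comp (Primrec.nat_double_succ.to_comp.comp (Computable.succ.comp Computable.encode))
    refine h.of_eq fun c => ?_
    rw [hodd]
    simp [g]

end TheoryCombination

theorem mainTheorem4 :
    (∃ f : ℕ → Bool, TheoryCombination.IsAdmissible f) ∧
    TheoryCombination.DecidableTheory TheoryCombination.theoryEq ∧
    TheoryCombination.StronglyFinitelyWitnessable TheoryCombination.theoryEq ∧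
    TheoryCombination.ComputableOnQF TheoryCombination.witEq ∧
    TheoryCombination.IsStrongWitness TheoryCombination.theoryEq TheoryCombination.witEq ∧
    ¬ TheoryCombination.Smooth TheoryCombination.theoryEq ∧
    ∀ f : ℕ → Bool, TheoryCombination.IsAdmissible f →
      TheoryCombination.DecidableTheory (TheoryCombination.theoryF f) ∧
      ¬ TheoryCombination.DecidableTheory
        (TheoryCombination.combination (TheoryCombination.theoryF f) TheoryCombination.theoryEq) :=
  ⟨TheoryCombination.exists_isAdmissible, TheoryCombination.decidableTheory_theoryEq,
    ⟨_, TheoryCombination.computableOnQF_witEq, TheoryCombination.isStrongWitness_witEq⟩,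
    TheoryCombination.computableOnQF_witEq, TheoryCombination.isStrongWitness_witEq,
    TheoryCombination.not_smooth_theoryEq, fun f hf =>
      ⟨TheoryCombination.decidableTheory_theoryF f, fun h => hf.not_computable
        (TheoryCombination.computable_of_decidableTheory_combination f hf.one h)⟩⟩
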